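/- Let $n \ge 1$ and let $\Theta = (\theta_1, \dots, \theta_n) \in \mathbf{R}^n$ be such that $1, \theta_1, \dots, \theta_n$ are linearly independent over $\mathbf{Q}$. Put $\mathbf{y} = (1, \theta_1, \dots, \theta_n)$ and identify $\Theta$ with the point of $\mathbf{P}^n(\mathbf{R})$ with homogeneous coordinates $\mathbf{y}$. Write $|\cdot|$ for the Euclidean norm on $\mathbf{R}^{n+1}$ and on each $\Lambda^r(\mathbf{R}^{n+1})$ (for which the $\mathbf{e}_{i_1} \wedge \cdots \wedge \mathbf{e}_{i_r}$, $i_1 < \cdots < i_r$, form an orthonormal basis, $(\mathbf{e}_i)$ being the canonical basis of $\mathbf{R}^{n+1}$), and let $\Lambda^{r}(\mathbf{Z}^{n+1})$ be the lattice of integer combinations of the $\mathbf{e}_{i_1} \wedge \cdots \wedge \mathbf{e}_{i_r}$. For points $P, Q \in \mathbf{P}^n(\mathbf{R})$ with homogeneous coordinates $\mathbf{x}, \mathbf{z}$, let $\mathrm{d}(P,Q) = |\mathbf{x} \wedge \mathbf{z}| / (|\mathbf{x}|\,|\mathbf{z}|)$, and for a real linear subvariety $L \subset \mathbf{P}^n(\mathbf{R})$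 let $\mathrm{d}(\Theta, L) = \min_{P \in L} \mathrm{d}(\Theta, P)$. If $L$ is rational over $\mathbf{Q}$, let $H(L)$ be the Weil height of any system of rational Plücker coordinates $(X_I)$ of $L$, normalized by the Euclidean norm at the Archimedean place: $H(L) = \big(\sum_I X_I^2\big)^{1/2} \prod_{p} \max_I |X_I|_p$. For an integer $d$ with $0 \le d \le n-1$, let $\omega_d(\Theta) \in [-\infty, +\infty]$ be the supremum of the real numbers $\omega$ for which there exist infinitely many rational linear subvarieties $L \subset \mathbf{P}^n(\mathbf{R})$ with $$\dim(L) = d \quad\text{and}\quad \mathrm{d}(\Theta, L) \le H(L)^{-1-\omega}.$$ **Proposition.** For every integer $d$ with $0 \le d \le n-1$, the exponent $\omega_d(\Theta)$ is equal to the supremum (in $[-\infty, +\infty]$) of the real numbers $\omega$ for which there exist infinitely many integer multivectors $\mathbf{X} \in \Lambda^{d+1}(\mathbf{Z}^{n+1})$, not necessarily decomposable, such that $$|\mathbf{y} \wedge \mathbf{X}| \le |\mathbf{X}|^{-\omega}.$$ -/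

import Mathlib

open scoped LinearAlgebra.Projectivization

noncomputable section

namespace SubspaceApprox

/-- The Euclidean space `ℝ^(n+1)`, with coordinates indexed by `0, …, n`. -/
abbrev E (n : ℕ) : Type := EuclideanSpace ℝ (Fin (n + 1))

/-! ### Multivectors

`⋀[ℝ]^r (E n)` carries Mathlib's inner product, for which the wedge products
`e_{i_1} ∧ ⋯ ∧ e_{i_r}` of an orthonormal basis form an orthonormal basis. -/

/-- The wedge product `y ∧ X` of a vector with an `r`-vector, taken in the exterior algebra. -/
def wedge {n r : ℕ} (y : E n) (X : ⋀[ℝ]^r (E n)) : ⋀[ℝ]^(r + 1) (E n) :=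
  ⟨ExteriorAlgebra.ι ℝ y * (X : ExteriorAlgebra ℝ (E n)), by
    rw [ExteriorAlgebra.exteriorPower, pow_succ']
    exact Submodule.mul_mem_mul (LinearMap.mem_range_self _ _) X.2⟩

/-- The lattice `Λ^r(ℤ^(n+1))` inside `Λ^r(ℝ^(n+1))`: integer combinations of the
`e_{i_1} ∧ ⋯ ∧ e_{i_r}`, where `e_0, …, e_n` is the canonical basis. -/
def integerMultivectors (n r : ℕ) : Submodule ℤ (⋀[ℝ]^r (E n)) :=
  Submodule.span ℤ
    (Set.range ((EuclideanSpace.basisFun (Fin (n + 1)) ℝ).toBasis.exteriorPower r))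

/-! ### Projective distance -/

/-- The projective distance `|x ∧ y| / (|x| |y|)` of the points with homogeneous coordinates
`x` and `y`. -/
def projDist {n : ℕ} (P Q : ℙ ℝ (E n)) : ℝ :=
  ‖exteriorPower.ιMulti ℝ 2 ![P.rep, Q.rep]‖ / (‖P.rep‖ * ‖Q.rep‖)

/-- The projective distance does not depend on the homogeneous coordinates. -/
lemma projDist_mk {n : ℕ} (x y : E n) (hx : x ≠ 0) (hy : y ≠ 0) :
    projDist (Projectivization.mk ℝ x hx) (Projectivization.mk ℝ y hy) =
      ‖exteriorPower.ιMulti ℝ 2 ![x, y]‖ / (‖x‖ * ‖y‖) := by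
  obtain ⟨a, ha⟩ := Projectivization.exists_smul_eq_mk_rep ℝ x hx
  obtain ⟨b, hb⟩ := Projectivization.exists_smul_eq_mk_rep ℝ y hy
  have key : exteriorPower.ιMulti ℝ 2 ![a • x, b • y]
      = ((a : ℝ) * (b : ℝ)) • exteriorPower.ιMulti ℝ 2 ![x, y] := by
    have h := (exteriorPower.ιMulti ℝ 2).map_smul_univ ![(a : ℝ), (b : ℝ)] ![x, y]
    have e : (fun i => ![(a : ℝ), (b : ℝ)] i • ![x, y] i) = ![a • x, b • y] := by
      ext i : 1
      fin_cases i <;> rfl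
    rw [e] at h
    simpa using h
  rw [projDist, ← ha, ← hb, key, norm_smul, Units.smul_def, Units.smul_def, norm_smul, norm_smul,
    norm_mul]
  have h1 : ‖(a : ℝ)‖ ≠ 0 := norm_ne_zero_iff.2 a.ne_zero
  have h2 : ‖(b : ℝ)‖ ≠ 0 := norm_ne_zero_iff.2 b.ne_zero
  have h3 : ‖x‖ ≠ 0 := norm_ne_zero_iff.2 hx
  have h4 : ‖y‖ ≠ 0 := norm_ne_zero_iff.2 hy
  field_simp

/-- The minimal distance from `P` to the real points of the linear subvariety `ℙ(L)`. -/
def distTo {n : ℕ} (P : ℙ ℝ (E n)) (L : Submodule ℝ (E n)) : ℝ :=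
  ⨅ Q : {Q : ℙ ℝ (E n) // Q.submodule ≤ L}, projDist P Q

/-! ### Rational linear subvarieties and their height

A linear subvariety of `ℙ^n(ℝ)` of dimension `d` is `ℙ(L)` for a real subspace `L` of `ℝ^(n+1)`
of dimension `d + 1`. -/

/-- A rational vector, viewed in `ℝ^(n+1)`. -/
def ratVec {n : ℕ} (q : Fin (n + 1) → ℚ) : E n :=
  WithLp.toLp 2 (fun i => (q i : ℝ))

/-- The `ℚ`-vector space of rational vectors lying in `L`. -/
def rationalPoints {n : ℕ} (L : Submodule ℝ (E n)) : Submodule ℚ (Fin (n + 1) → ℚ) where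
  carrier := {q | ratVec q ∈ L}
  zero_mem' := by
    have : ratVec (0 : Fin (n + 1) → ℚ) = 0 := by
      ext i
      simp [ratVec]
    simp [this]
  add_mem' {p q} hp hq := by
    have : ratVec (p + q) = ratVec p + ratVec q := by
      ext i
      simp [ratVec]
    simpa [this] using L.add_mem hp hq
  smul_mem' c q hq := by
    have : ratVec (c • q) = (c : ℝ) • ratVec q := by
      ext i
      simp [ratVec]
    simpa [this] using L.smul_mem (c : ℝ) hq

/-- `L` is rational over `ℚ`: it is spanned by rational vectors. -/
def IsRational {n : ℕ} (L : Submodule ℝ (E n)) : Prop :=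
  Submodule.span ℝ (ratVec '' (rationalPoints L : Set (Fin (n + 1) → ℚ))) = L

/-- The Weil height over `ℚ` of a nonzero tuple of homogeneous coordinates, normalized by the
Euclidean norm at the Archimedean place. -/
def weilHeight {ι : Type*} [Fintype ι] (x : ι → ℚ) : ℝ :=
  √(∑ i, (x i : ℝ) ^ 2) * ∏ᶠ v : NumberField.FinitePlace ℚ, ⨆ i, v (x i)

/-- The Weil height of a point does not depend on its homogeneous coordinates. -/
lemma weilHeight_smul {ι : Type*} [Fintype ι] (x : ι → ℚ) (c : ℚ) (hc : c ≠ 0) :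
    weilHeight (c • x) = weilHeight x := by
  rcases eq_or_ne x 0 with rfl | hx
  · rw [smul_zero]
  have hsupp : (fun v : NumberField.FinitePlace ℚ => ⨆ i, v (x i)).HasFiniteMulSupport := by
    obtain ⟨i, hi⟩ := Function.ne_iff.mp hx
    have : Nonempty {j // x j ≠ 0} := ⟨⟨i, hi⟩⟩
    have e : (fun v : NumberField.FinitePlace ℚ => ⨆ i, v (x i)) =
        fun v : NumberField.FinitePlace ℚ => ⨆ i : {j // x j ≠ 0}, v (x i) := by
      funext v
      exact Finite.iSup_eq_iSup_subtype hx
    rw [e]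
    exact Function.HasFiniteMulSupport.iSup fun i => NumberField.FinitePlace.hasFiniteMulSupport i.2
  have hprod : |(c : ℝ)| * ∏ᶠ v : NumberField.FinitePlace ℚ, v c = 1 := by
    have h := NumberField.prod_abs_eq_one hc
    simpa using h
  have hsqrt : √(∑ i, (((c • x) i : ℚ) : ℝ) ^ 2) = |(c : ℝ)| * √(∑ i, (x i : ℝ) ^ 2) := by
    simp only [Pi.smul_apply, smul_eq_mul, Rat.cast_mul, mul_pow, ← Finset.mul_sum]
    rw [Real.sqrt_mul (sq_nonneg _), Real.sqrt_sq_eq_abs]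
  have hfin : ∏ᶠ v : NumberField.FinitePlace ℚ, ⨆ i, v ((c • x) i) =
      (∏ᶠ v : NumberField.FinitePlace ℚ, v c) * ∏ᶠ v : NumberField.FinitePlace ℚ, ⨆ i, v (x i) := by
    rw [← finprod_mul_distrib (NumberField.FinitePlace.hasFiniteMulSupport hc) hsupp]
    refine finprod_congr fun v => ?_
    simp only [Pi.smul_apply, smul_eq_mul, map_mul]
    rw [Real.mul_iSup_of_nonneg (apply_nonneg v c)]
  rw [weilHeight, weilHeight, hsqrt, hfin, mul_mul_mul_comm, hprod, one_mul]

/-- The coordinates of `v_1 ∧ ⋯ ∧ v_r` in the canonical basis of `Λ^r(ℚ^(n+1))`. -/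
def pluckerCoord {n r : ℕ} (v : Fin r → (Fin (n + 1) → ℚ)) :
    Set.powersetCard (Fin (n + 1)) r → ℚ :=
  fun s => ((Pi.basisFun ℚ (Fin (n + 1))).exteriorPower r).repr (exteriorPower.ιMulti ℚ r v) s

/-- The height of a rational `L`: the Weil height of a system of Plücker coordinates of `L`. -/
def height {n : ℕ} (L : Submodule ℝ (E n)) : ℝ :=
  weilHeight (pluckerCoord
    (fun i => (Module.finBasis ℚ (rationalPoints L) i : Fin (n + 1) → ℚ)))

/-- Every system of Plücker coordinates computes the height. -/
lemma height_eq {n r : ℕ} (L : Submodule ℝ (E n)) (b : Module.Basis (Fin r) ℚ (rationalPoints L)) :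
    height L = weilHeight (pluckerCoord (fun i => (b i : Fin (n + 1) → ℚ))) := by
  obtain rfl : r = Module.finrank ℚ (rationalPoints L) := by
    simpa using (Module.finrank_eq_card_basis b).symm
  set b₀ := Module.finBasis ℚ (rationalPoints L)
  have key : pluckerCoord (fun i => (b i : Fin (n + 1) → ℚ)) =
      b₀.det b • pluckerCoord (fun i => (b₀ i : Fin (n + 1) → ℚ)) := by
    funext s
    let f : (rationalPoints L) [⋀^Fin (Module.finrank ℚ (rationalPoints L))]→ₗ[ℚ] ℚ :=
      ((((Pi.basisFun ℚ (Fin (n + 1))).exteriorPower _).coord s).compAlternatingMap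
        (exteriorPower.ιMulti ℚ _)).compLinearMap (rationalPoints L).subtype
    have h := congrArg (fun g => g b) (f.eq_smul_basis_det b₀)
    have hb : pluckerCoord (fun i => (b i : Fin (n + 1) → ℚ)) s = f b := rfl
    have hb₀ : pluckerCoord (fun i => (b₀ i : Fin (n + 1) → ℚ)) s = f b₀ := rfl
    rw [Pi.smul_apply, hb, hb₀, smul_eq_mul, mul_comm]
    exact h
  rw [height, key, weilHeight_smul _ _ (b₀.isUnit_det b).ne_zero]

/-! ### The exponents -/

/-- The homogeneous coordinates `y = (1, θ_1, …, θ_n)` of `Θ`. -/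
def homog {n : ℕ} (θ : Fin n → ℝ) : E n :=
  WithLp.toLp 2 (Fin.cons 1 θ)

lemma homog_ne_zero {n : ℕ} (θ : Fin n → ℝ) : homog θ ≠ 0 := by
  intro h
  have := congrArg (fun v : E n => v 0) h
  simp [homog] at this

/-- `Θ` as a point of `ℙ^n(ℝ)`. -/
def point {n : ℕ} (θ : Fin n → ℝ) : ℙ ℝ (E n) :=
  Projectivization.mk ℝ (homog θ) (homog_ne_zero θ)

/-- The exponent `ω_d(Θ)` of approximation to `Θ` by rational linear subvarieties of dimension
`d`: a supremum in `[-∞, +∞]`. -/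
def omega {n : ℕ} (d : ℕ) (θ : Fin n → ℝ) : EReal :=
  sSup (Real.toEReal '' {ω : ℝ | {L : Submodule ℝ (E n) |
    IsRational L ∧ Module.finrank ℝ L = d + 1 ∧
      distTo (point θ) L ≤ height L ^ (-1 - ω)}.Infinite})

end SubspaceApprox

end

namespace SubspaceApprox

/-! ### Wedge products and orthogonal projections -/

/-! Rational subspaces and decomposable integer multivectors are almost the same objects. Wedging
`y` with `v_1 ∧ ⋯ ∧ v_r` multiplies the norm by the distance from `y` to the span `L`
(`norm_wedge_ιMulti`), so `|y ∧ X| = |y| |X| d(Θ, L)` when `X` is a multiple of that wedge; and the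
primitive integer multivector of `L` has norm `H(L)` (`exists_integerMultivector`). Subspaces of
exponent `ω` thus give multivectors of every exponent `ω' < ω`, the loss absorbing the constant
`|y|`.

Conversely, an integer multivector `X` need not be decomposable, and `exists_decomposable_le`
replaces it by one that is. In a basis `F` of `ℝ^(n+1)` with `F 0 = y`, the bounds `|X| ≤ Q` and `|y
∧ X| ≤ ε` say that the coordinates `X_I` are `≪ Q` for all `I` and `≪ ε` when `0 ∉ I`. Weights on
the coordinates turn these into one uniform bound `K`. Take a basis of `ℤ^(n+1)` reduced for the
weighted norm (`exists_reduced_basis`). Since `X ≠ 0`, one of its coordinates in the induced basis,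
say that of index `J`, is a nonzero integer; almost orthogonality then bounds the product of the
lengths of the basis vectors indexed by `J` by `≪ K`. The first `r` basis vectors have a product of
lengths no larger, up to a constant, and their wedge is the multivector sought. This is the idea of
Mahler's compound bodies, with a reduced basis in place of successive minima.

Infinitely many subspaces arise because `y` lies on no proper rational subspace: distances tending
to `0` cannot come from finitely many `L` (`infinite_approxSubspaces_of_forall`). This treats
exponents `≥ 0`; negative exponents are always reached by rounding multiples of `y`. -/

lemma wedge_ιMulti {n r : ℕ} (y : E n) (v : Fin r → E n) :
    wedge y (exteriorPower.ιMulti ℝ r v) = exteriorPower.ιMulti ℝ (r + 1) (Fin.cons y v) := by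
  apply Subtype.ext
  simp [wedge, ExteriorAlgebra.ιMulti_succ_apply, Matrix.vecTail, Function.comp_def]

lemma wedge_add {n r : ℕ} (y : E n) (X Y : ⋀[ℝ]^r (E n)) :
    wedge y (X + Y) = wedge y X + wedge y Y := by
  apply Subtype.ext
  simp [wedge, mul_add]

lemma wedge_smul {n r : ℕ} (y : E n) (c : ℝ) (X : ⋀[ℝ]^r (E n)) :
    wedge y (c • X) = c • wedge y X := by
  apply Subtype.ext
  simp [wedge]

lemma add_wedge {n r : ℕ} (y z : E n) (X : ⋀[ℝ]^r (E n)) :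
    wedge (y + z) X = wedge y X + wedge z X := by
  apply Subtype.ext
  simp [wedge, add_mul]

lemma smul_wedge {n r : ℕ} (y : E n) (c : ℝ) (X : ⋀[ℝ]^r (E n)) :
    wedge (c • y) X = c • wedge y X := by
  apply Subtype.ext
  simp [wedge]

lemma wedge_ιMulti_of_mem_span {n r : ℕ} {u : E n} {v : Fin r → E n}
    (hu : u ∈ Submodule.span ℝ (Set.range v)) :
    wedge u (exteriorPower.ιMulti ℝ r v) = 0 := by
  induction hu using Submodule.span_induction with
  | mem x hx =>
    obtain ⟨i, rfl⟩ := hx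
    rw [wedge_ιMulti]
    exact (exteriorPower.ιMulti ℝ (r + 1)).map_eq_zero_of_eq _
      (i := 0) (j := i.succ) (by simp) (Fin.succ_ne_zero i).symm
  | zero => simpa using smul_wedge (0 : E n) 0 (exteriorPower.ιMulti ℝ r v)
  | add x y _ _ hx hy => rw [add_wedge, hx, hy, add_zero]
  | smul c x _ hx => rw [smul_wedge, hx, smul_zero]

lemma norm_ιMulti_sq {n r : ℕ} (v : Fin r → E n) :
    ‖exteriorPower.ιMulti ℝ r v‖ ^ 2 = (Matrix.gram ℝ v).det := by
  rw [← exteriorPower.inner_ιMulti_self, real_inner_self_eq_norm_sq]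

/-- Orthogonality leaves only the corner entry `‖w‖²` in the first column of the Gram matrix. -/
lemma norm_ιMulti_cons_of_orthogonal {n r : ℕ} {w : E n} {v : Fin r → E n}
    (hw : ∀ i, inner ℝ (v i) w = 0) :
    ‖exteriorPower.ιMulti ℝ (r + 1) (Fin.cons w v)‖ = ‖w‖ * ‖exteriorPower.ιMulti ℝ r v‖ := by
  have h : ‖exteriorPower.ιMulti ℝ (r + 1) (Fin.cons w v)‖ ^ 2 =
      (‖w‖ * ‖exteriorPower.ιMulti ℝ r v‖) ^ 2 := by
    rw [mul_pow, norm_ιMulti_sq, norm_ιMulti_sq, Matrix.det_succ_column_zero, Fin.sum_univ_succ,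
      Finset.sum_eq_zero]
    · have : (Matrix.gram ℝ (Fin.cons w v)).submatrix (Fin.succAbove 0) Fin.succ =
        Matrix.gram ℝ v := by
        ext i j
        simp [Matrix.gram]
      rw [this]
      simp [Matrix.gram]
    · intro i _
      simp [Matrix.gram, hw i]
  exact (pow_left_inj₀ (norm_nonneg _) (by positivity) two_ne_zero).1 h

/-- Wedging with `y` multiplies the norm of a decomposable multivector by the distance from `y`
to the associated subspace. -/
lemma norm_wedge_ιMulti {n r : ℕ} (y : E n) (v : Fin r → E n) :
    ‖wedge y (exteriorPower.ιMulti ℝ r v)‖ =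
      ‖y - (Submodule.span ℝ (Set.range v)).starProjection y‖ * ‖exteriorPower.ιMulti ℝ r v‖ := by
  set L := Submodule.span ℝ (Set.range v)
  have h : wedge y (exteriorPower.ιMulti ℝ r v) =
      wedge (y - L.starProjection y) (exteriorPower.ιMulti ℝ r v) := by
    conv_lhs => rw [← sub_add_cancel y (L.starProjection y)]
    rw [add_wedge, wedge_ιMulti_of_mem_span (L.starProjection_apply_mem y), add_zero]
  rw [h, wedge_ιMulti]
  apply norm_ιMulti_cons_of_orthogonal
  intro i
  have := Submodule.sub_starProjection_mem_orthogonal (K := L) y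
  exact this _ (Submodule.subset_span ⟨i, rfl⟩)

lemma projDist_mk_eq {n : ℕ} (y z : E n) (hy : y ≠ 0) (hz : z ≠ 0) :
    projDist (Projectivization.mk ℝ y hy) (Projectivization.mk ℝ z hz) =
      ‖y - (Submodule.span ℝ {z}).starProjection y‖ / ‖y‖ := by
  have h := norm_wedge_ιMulti y ![z]
  have h1 := norm_ιMulti_cons_of_orthogonal (w := z) (v := (![] : Fin 0 → E n)) (by simp)
  have h0 : ‖exteriorPower.ιMulti ℝ 0 (![] : Fin 0 → E n)‖ = 1 := by
    have := norm_ιMulti_sq (![] : Fin 0 → E n)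
    rw [Matrix.det_isEmpty] at this
    exact (pow_eq_one_iff_of_nonneg (norm_nonneg _) two_ne_zero).1 this
  rw [h0, mul_one] at h1
  rw [wedge_ιMulti] at h
  have e : (Set.range ![z]) = {z} := by simp
  have e1 : ‖exteriorPower.ιMulti ℝ 1 ![z]‖ = ‖z‖ := h1
  have e2 : ‖exteriorPower.ιMulti ℝ 2 ![y, z]‖ =
    ‖exteriorPower.ιMulti ℝ (1 + 1) (Fin.cons y ![z])‖ := rfl
  rw [projDist_mk, e2, h, e, e1, mul_div_mul_right _ _ (norm_ne_zero_iff.2 hz)]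

lemma norm_sub_starProjection_le {n : ℕ} (L : Submodule ℝ (E n)) (y : E n) {z : E n}
    (hz : z ∈ L) : ‖y - L.starProjection y‖ ≤ ‖y - z‖ := by
  rw [Submodule.starProjection_minimal]
  exact ciInf_le ⟨0, by rintro _ ⟨x, rfl⟩; exact norm_nonneg _⟩ (⟨z, hz⟩ : L)

/-- The minimum is attained at the orthogonal projection of `y`, when this is a projective point. -/
lemma distTo_mk {n : ℕ} (y : E n) (hy : y ≠ 0) (L : Submodule ℝ (E n)) (hL : L ≠ ⊥) :
    distTo (Projectivization.mk ℝ y hy) L = ‖y - L.starProjection y‖ / ‖y‖ := by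
  have hpos : 0 < ‖y‖ := norm_pos_iff.2 hy
  have hbdd : BddBelow (Set.range fun Q : {Q : ℙ ℝ (E n) // Q.submodule ≤ L} =>
      projDist (Projectivization.mk ℝ y hy) Q) := by
    refine ⟨0, ?_⟩
    rintro _ ⟨Q, rfl⟩
    simp only [projDist]
    positivity
  have hle : ∀ z : E n, ∀ hz : z ≠ 0, z ∈ L →
      distTo (Projectivization.mk ℝ y hy) L ≤
        ‖y - (Submodule.span ℝ {z}).starProjection y‖ / ‖y‖ := by
    intro z hz hzL
    rw [← projDist_mk_eq y z hy hz]
    refine ciInf_le hbdd ⟨Projectivization.mk ℝ z hz, ?_⟩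
    rw [Projectivization.submodule_mk, Submodule.span_singleton_le_iff_mem]
    exact hzL
  obtain ⟨z₀, hz₀L, hz₀⟩ := Submodule.exists_mem_ne_zero_of_ne_bot hL
  apply le_antisymm
  -- If the projection vanishes it defines no projective point, but then any point of `L` will do.
  · by_cases h : L.starProjection y = 0
    · refine (hle z₀ hz₀ hz₀L).trans ?_
      gcongr
      rw [h]
      exact norm_sub_starProjection_le _ _ (zero_mem _)
    · refine (hle _ h (L.starProjection_apply_mem y)).trans ?_
      gcongr
      exact norm_sub_starProjection_le _ _ (Submodule.mem_span_singleton_self _)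
  · have : Nonempty {Q : ℙ ℝ (E n) // Q.submodule ≤ L} :=
      ⟨⟨Projectivization.mk ℝ z₀ hz₀, by
        rwa [Projectivization.submodule_mk, Submodule.span_singleton_le_iff_mem]⟩⟩
    refine le_ciInf ?_
    rintro ⟨Q, hQ⟩
    induction Q using Projectivization.ind with
    | h z hz =>
      rw [Projectivization.submodule_mk] at hQ
      simp only [projDist_mk_eq]
      gcongr
      exact norm_sub_starProjection_le _ _ (hQ (Submodule.starProjection_apply_mem _ _))

lemma ιMulti_ne_zero {n r : ℕ} {v : Fin r → E n} (hv : LinearIndependent ℝ v) :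
    exteriorPower.ιMulti ℝ r v ≠ 0 := by
  intro h
  have h2 := norm_ιMulti_sq v
  rw [h] at h2
  have := Matrix.PosDef.det_pos (Matrix.posDef_gram_of_linearIndependent hv)
  simp at h2
  linarith

/-- The distance from a point to a subspace with basis `v`. -/
lemma norm_wedge_eq_distTo {n r : ℕ} (y : E n) (hy : y ≠ 0) {v : Fin (r + 1) → E n}
    (hv : LinearIndependent ℝ v) :
    ‖wedge y (exteriorPower.ιMulti ℝ (r + 1) v)‖ =
      ‖y‖ * ‖exteriorPower.ιMulti ℝ (r + 1) v‖ *
        distTo (Projectivization.mk ℝ y hy) (Submodule.span ℝ (Set.range v)) := by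
  have hL : Submodule.span ℝ (Set.range v) ≠ ⊥ := by
    intro h
    exact hv.ne_zero 0 (Submodule.span_eq_bot.1 h _ ⟨0, rfl⟩)
  rw [norm_wedge_ιMulti, distTo_mk y hy _ hL]
  have : ‖y‖ ≠ 0 := norm_ne_zero_iff.2 hy
  field_simp

lemma distTo_pos {n : ℕ} (y : E n) (hy : y ≠ 0) {L : Submodule ℝ (E n)} (hL : L ≠ ⊥)
    (hyL : y ∉ L) : 0 < distTo (Projectivization.mk ℝ y hy) L := by
  rw [distTo_mk y hy _ hL]
  refine div_pos (norm_pos_iff.2 ?_) (norm_pos_iff.2 hy)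
  intro h
  apply hyL
  rw [sub_eq_zero.1 h]
  exact L.starProjection_apply_mem y

/-- A decomposable multivector determines its subspace, so distinct subspaces give distinct
multivectors. -/
lemma wedge_ιMulti_eq_zero_iff {n r : ℕ} {y : E n} {v : Fin r → E n}
    (hv : LinearIndependent ℝ v) :
    wedge y (exteriorPower.ιMulti ℝ r v) = 0 ↔ y ∈ Submodule.span ℝ (Set.range v) := by
  refine ⟨fun h => ?_, wedge_ιMulti_of_mem_span⟩
  have := norm_wedge_ιMulti y v
  rw [h, norm_zero, zero_eq_mul, or_iff_left (norm_ne_zero_iff.2 (ιMulti_ne_zero hv)),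
    norm_eq_zero, sub_eq_zero] at this
  rw [this]
  exact Submodule.starProjection_apply_mem _ _

/-! ### Plücker coordinates of rational and integer vectors -/

/-- The canonical basis of `Λ^r(ℝ^(n+1))`. -/
noncomputable def multiBasis (n r : ℕ) :
    Module.Basis (Set.powersetCard (Fin (n + 1)) r) ℝ (⋀[ℝ]^r (E n)) :=
  (EuclideanSpace.basisFun (Fin (n + 1)) ℝ).toBasis.exteriorPower r

lemma mem_integerMultivectors_iff {n r : ℕ} (X : ⋀[ℝ]^r (E n)) :
    X ∈ integerMultivectors n r ↔ ∀ s, ∃ k : ℤ, (k : ℝ) = (multiBasis n r).repr X s := by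
  rw [integerMultivectors, Module.Basis.mem_span_iff_repr_mem]
  rfl

lemma norm_eq_sqrt_sum_repr {n r : ℕ} (X : ⋀[ℝ]^r (E n)) :
    ‖X‖ = √(∑ s, (multiBasis n r).repr X s ^ 2) := by
  rw [← ((EuclideanSpace.basisFun (Fin (n + 1)) ℝ).exteriorPower r).repr.norm_map X,
    EuclideanSpace.norm_eq]
  congr 1
  refine Finset.sum_congr rfl fun s _ => ?_
  rw [Real.norm_eq_abs, sq_abs, ← OrthonormalBasis.coe_toBasis_repr_apply,
    OrthonormalBasis.toBasis_exteriorPower, multiBasis]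

lemma finite_integerMultivectors_le (n r : ℕ) (R : ℝ) :
    {X : ⋀[ℝ]^r (E n) | X ∈ integerMultivectors n r ∧ ‖X‖ ≤ R}.Finite := by
  have h := ZSpan.setFinite_inter (multiBasis n r)
    (Metric.isBounded_closedBall (x := (0 : ⋀[ℝ]^r (E n))) (r := R))
  refine h.subset ?_
  rintro X ⟨h1, h2⟩
  exact ⟨by simpa using h2, h1⟩

lemma one_le_norm_of_mem_integerMultivectors {n r : ℕ} {X : ⋀[ℝ]^r (E n)}
    (hX : X ∈ integerMultivectors n r) (h0 : X ≠ 0) : 1 ≤ ‖X‖ := by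
  rw [mem_integerMultivectors_iff] at hX
  have hs : ∃ s, (multiBasis n r).repr X s ≠ 0 := by
    by_contra! h
    exact h0 ((multiBasis n r).ext_elem (by simpa using h))
  obtain ⟨s, hs⟩ := hs
  obtain ⟨k, hk⟩ := hX s
  have hk0 : k ≠ 0 := by
    rintro rfl
    exact hs (by simpa using hk.symm)
  have h1 : (1 : ℝ) ≤ (k : ℝ) ^ 2 := by
    exact_mod_cast Int.one_le_abs hk0 |>.trans (by rw [← sq_abs]; nlinarith [Int.one_le_abs hk0])
  rw [norm_eq_sqrt_sum_repr]
  refine Real.one_le_sqrt.2 (h1.trans ?_)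
  rw [hk]
  exact Finset.single_le_sum (f := fun s => (multiBasis n r).repr X s ^ 2)
    (fun _ _ => sq_nonneg _) (Finset.mem_univ s)

lemma repr_ιMulti_ratVec {n r : ℕ} (q : Fin r → Fin (n + 1) → ℚ)
    (s : Set.powersetCard (Fin (n + 1)) r) :
    (multiBasis n r).repr (exteriorPower.ιMulti ℝ r fun i => ratVec (q i)) s =
      (pluckerCoord q s : ℝ) := by
  rw [multiBasis, pluckerCoord, exteriorPower.basis_repr_apply, exteriorPower.basis_repr_apply,
    exteriorPower.ιMultiDual_apply_ιMulti, exteriorPower.ιMultiDual_apply_ιMulti,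
    ← eq_ratCast (Rat.castHom ℝ), RingHom.map_det]
  rfl

lemma linearIndependent_iff_ιMulti_ne_zero {K V : Type*} [Field K] [AddCommGroup V] [Module K V]
    {r : ℕ} (v : Fin r → V) : LinearIndependent K v ↔ exteriorPower.ιMulti K r v ≠ 0 := by
  refine ⟨fun h => ?_, fun h => ?_⟩
  · have h1 := (exteriorPower.ιMulti_family_linearIndependent_field r h).ne_zero
      (Set.powersetCard.ofFinEmbEquiv (RelEmbedding.refl _))
    simpa [exteriorPower.ιMulti_family] using h1
  · by_contra h'
    exact h (AlternatingMap.map_linearDependent _ _ h')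

lemma linearIndependent_iff_pluckerCoord_ne_zero {n r : ℕ} (q : Fin r → Fin (n + 1) → ℚ) :
    LinearIndependent ℚ q ↔ pluckerCoord q ≠ 0 := by
  rw [linearIndependent_iff_ιMulti_ne_zero, not_iff_not]
  refine ⟨fun h => by funext s; simp [pluckerCoord, h], fun h => ?_⟩
  exact ((Pi.basisFun ℚ (Fin (n + 1))).exteriorPower r).ext_elem fun s => by
    simpa [pluckerCoord] using congrFun h s

/-- Over `ℚ` and over `ℝ`, independence is the nonvanishing of the same minors. -/
lemma linearIndependent_ratVec_iff {n r : ℕ} (q : Fin r → Fin (n + 1) → ℚ) :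
    LinearIndependent ℝ (fun i => ratVec (q i)) ↔ LinearIndependent ℚ q := by
  rw [linearIndependent_iff_pluckerCoord_ne_zero, linearIndependent_iff_ιMulti_ne_zero,
    not_iff_not]
  refine ⟨fun h => ?_, fun h => ?_⟩
  · funext s
    have := repr_ιMulti_ratVec q s
    rw [h] at this
    simpa using this.symm
  · refine (multiBasis n r).ext_elem fun s => ?_
    rw [repr_ιMulti_ratVec, h]
    simp

/-! ### Rational subspaces -/

lemma linearIndependent_ratVec_basis {n r : ℕ} (L : Submodule ℝ (E n))
    (b : Module.Basis (Fin r) ℚ (rationalPoints L)) :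
    LinearIndependent ℝ (fun i => ratVec (b i : Fin (n + 1) → ℚ)) := by
  rw [linearIndependent_ratVec_iff]
  exact b.linearIndependent.map' (rationalPoints L).subtype (Submodule.ker_subtype _)

lemma span_ratVec_basis {n r : ℕ} {L : Submodule ℝ (E n)} (hL : IsRational L)
    (b : Module.Basis (Fin r) ℚ (rationalPoints L)) :
    Submodule.span ℝ (Set.range fun i => ratVec (b i : Fin (n + 1) → ℚ)) = L := by
  apply le_antisymm
  · rw [Submodule.span_le]
    rintro _ ⟨i, rfl⟩
    exact (b i).2
  · conv_lhs => rw [← hL]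
    rw [Submodule.span_le]
    rintro _ ⟨q, hq, rfl⟩
    have h : ratVec q = ∑ i, ((b.repr ⟨q, hq⟩ i : ℚ) : ℝ) • ratVec (b i : Fin (n + 1) → ℚ) := by
      have h1 := congrArg (fun z : rationalPoints L => (z : Fin (n + 1) → ℚ))
        (b.sum_repr ⟨q, hq⟩)
      ext j
      have h2 := congrArg (fun x : ℚ => (x : ℝ)) (congrFun h1 j)
      simp only [AddSubmonoidClass.coe_finsetSum, Submodule.coe_smul, Finset.sum_apply,
        Pi.smul_apply, smul_eq_mul, Rat.cast_sum, Rat.cast_mul] at h2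
      simp [ratVec, h2]
    rw [h]
    exact Submodule.sum_mem _ fun i _ => Submodule.smul_mem _ _ (Submodule.subset_span ⟨i, rfl⟩)

lemma finrank_rationalPoints {n : ℕ} {L : Submodule ℝ (E n)} (hL : IsRational L) :
    Module.finrank ℚ (rationalPoints L) = Module.finrank ℝ L := by
  have h := finrank_span_eq_card
    (linearIndependent_ratVec_basis L (Module.finBasis ℚ (rationalPoints L)))
  rw [span_ratVec_basis hL] at h
  simpa using h.symm

lemma isRational_span_ratVec {n r : ℕ} (q : Fin r → Fin (n + 1) → ℚ) :
    IsRational (Submodule.span ℝ (Set.range fun i => ratVec (q i))) := by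
  apply le_antisymm
  · rw [Submodule.span_le]
    rintro _ ⟨p, hp, rfl⟩
    exact hp
  · rw [Submodule.span_le]
    rintro _ ⟨i, rfl⟩
    exact Submodule.subset_span ⟨q i, Submodule.subset_span ⟨i, rfl⟩, rfl⟩

/-! ### Heights and norms of integer multivectors -/

lemma weilHeight_of_gcd_eq_one {ι : Type*} [Fintype ι] [Nonempty ι] {x : ι → ℤ}
    (hx : Finset.univ.gcd x = 1) :
    weilHeight (fun i => (x i : ℚ)) = √(∑ i, (x i : ℝ) ^ 2) := by
  have h : ∏ᶠ v : NumberField.FinitePlace ℚ, ⨆ i, v ((x i : ℚ)) = 1 :=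
    finprod_eq_one_of_forall_eq_one fun v => Rat.iSup_finitePlace_apply_eq_one_of_gcd_eq_one v hx
  simp [weilHeight, h]

lemma exists_primitive_integer_multiple {ι : Type*} [Fintype ι] [Nonempty ι] {x : ι → ℚ}
    (hx : x ≠ 0) : ∃ (c : ℚ) (z : ι → ℤ), c ≠ 0 ∧ (∀ i, (z i : ℚ) = c * x i) ∧
      Finset.univ.gcd z = 1 := by
  obtain ⟨m, hm⟩ := IsLocalization.exist_integer_multiples_of_finite (nonZeroDivisors ℤ) x
  choose w hw using hm
  obtain ⟨z, hz, hz1⟩ := Finset.extract_gcd (s := Finset.univ) w Finset.univ_nonempty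
  have hm0 : ((m : ℤ) : ℚ) ≠ 0 := by
    exact_mod_cast nonZeroDivisors.coe_ne_zero m
  have hw' : ∀ i, (w i : ℚ) = (m : ℤ) * x i := fun i => by simpa using hw i
  set g := Finset.univ.gcd w
  have hg : (g : ℚ) ≠ 0 := by
    intro hg
    apply hx
    funext i
    have h1 := hw' i
    rw [hz i (Finset.mem_univ i), Int.cast_mul, hg, zero_mul] at h1
    exact (mul_eq_zero.1 h1.symm).resolve_left hm0
  refine ⟨(m : ℤ) / g, z, div_ne_zero hm0 hg, fun i => ?_, hz1⟩
  have h1 := hw' i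
  rw [hz i (Finset.mem_univ i), Int.cast_mul] at h1
  field_simp
  linarith

/-- A rational subspace corresponds to a primitive integer multivector, whose norm is its
height. -/
lemma exists_integerMultivector {n r : ℕ} {L : Submodule ℝ (E n)}
    (b : Module.Basis (Fin r) ℚ (rationalPoints L)) :
    ∃ (c : ℝ) (X : ⋀[ℝ]^r (E n)), c ≠ 0 ∧ X ∈ integerMultivectors n r ∧ ‖X‖ = height L ∧
      X = c • exteriorPower.ιMulti ℝ r (fun i => ratVec (b i : Fin (n + 1) → ℚ)) ∧
      ∀ t : ℝ, t ≠ 0 → t • X ∈ integerMultivectors n r → ‖X‖ ≤ ‖t • X‖ := by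
  set q : Fin r → Fin (n + 1) → ℚ := fun i => b i
  have hq : pluckerCoord q ≠ 0 := by
    rw [← linearIndependent_iff_pluckerCoord_ne_zero, ← linearIndependent_ratVec_iff]
    exact linearIndependent_ratVec_basis L b
  obtain ⟨s₀, -⟩ := Function.ne_iff.1 hq
  have : Nonempty (Set.powersetCard (Fin (n + 1)) r) := ⟨s₀⟩
  obtain ⟨c, z, hc, hz, hz1⟩ := exists_primitive_integer_multiple hq
  have hrepr : ∀ s, (multiBasis n r).repr
      ((c : ℝ) • exteriorPower.ιMulti ℝ r (fun i => ratVec (q i))) s = (z s : ℝ) := by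
    intro s
    rw [map_smul, Finsupp.smul_apply, repr_ιMulti_ratVec, smul_eq_mul]
    exact_mod_cast (congrArg (fun x : ℚ => (x : ℝ)) (hz s)).symm
  refine ⟨c, _, by exact_mod_cast hc, ?_, ?_, rfl, ?_⟩
  · rw [mem_integerMultivectors_iff]
    exact fun s => ⟨z s, (hrepr s).symm⟩
  · rw [norm_eq_sqrt_sum_repr, height_eq L b, ← weilHeight_smul _ c hc]
    have : c • pluckerCoord q = fun i => (z i : ℚ) := by
      funext s
      simp [hz]
    rw [this, weilHeight_of_gcd_eq_one hz1]
    exact congrArg Real.sqrt (Finset.sum_congr rfl fun s _ => by rw [hrepr])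
  · intro t ht htX
    rw [mem_integerMultivectors_iff] at htX
    choose k hk using htX
    obtain ⟨f, hf⟩ := Finset.gcd_eq_sum_mul .univ z
    -- A Bézout relation between the coprime coordinates of `X` shows that `t` is an integer, hence
    -- `|t| ≥ 1`.
    have h1 : t = ((∑ s, k s * f s : ℤ) : ℝ) := by
      rw [hz1] at hf
      have h2 : (1 : ℝ) = ∑ s, (z s : ℝ) * f s := by exact_mod_cast hf
      calc t = t * 1 := (mul_one t).symm
        _ = _ := by
          rw [h2, Finset.mul_sum]
          push_cast
          refine Finset.sum_congr rfl fun s _ => ?_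
          rw [hk, map_smul, Finsupp.smul_apply, hrepr, smul_eq_mul, mul_assoc]
    have h2 : 1 ≤ |t| := by
      have h3 : (∑ s, k s * f s : ℤ) ≠ 0 := by
        intro h
        rw [h, Int.cast_zero] at h1
        exact ht h1
      rw [h1]
      exact_mod_cast Int.one_le_abs h3
    rw [norm_smul t, Real.norm_eq_abs]
    exact le_mul_of_one_le_left (norm_nonneg _) h2

/-- An integer vector, viewed in `ℝ^(n+1)`. -/
noncomputable def intVec {n : ℕ} (m : Fin (n + 1) → ℤ) : E n :=
  ratVec fun j => (m j : ℚ)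

lemma ιMulti_intVec_mem {n r : ℕ} (m : Fin r → Fin (n + 1) → ℤ) :
    exteriorPower.ιMulti ℝ r (fun i => intVec (m i)) ∈ integerMultivectors n r := by
  rw [mem_integerMultivectors_iff]
  intro s
  rw [multiBasis, exteriorPower.basis_repr_apply, exteriorPower.ιMultiDual_apply_ιMulti]
  refine ⟨(Matrix.of fun i j => m i (Set.powersetCard.ofFinEmbEquiv.symm s j)).det, ?_⟩
  rw [← eq_intCast (Int.castRingHom ℝ), RingHom.map_det]
  congr 1

/-- The height of the subspace spanned by independent integer vectors is at most the norm of their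
wedge product. -/
lemma height_span_intVec {n r : ℕ} {m : Fin r → Fin (n + 1) → ℤ}
    (hm : LinearIndependent ℝ fun i => intVec (m i)) :
    0 < height (Submodule.span ℝ (Set.range fun i => intVec (m i))) ∧
      height (Submodule.span ℝ (Set.range fun i => intVec (m i))) ≤
        ‖exteriorPower.ιMulti ℝ r (fun i => intVec (m i))‖ := by
  set L := Submodule.span ℝ (Set.range fun i => intVec (m i)) with hLdef
  set q : Fin r → Fin (n + 1) → ℚ := fun i j => (m i j : ℚ)
  have hqL : ∀ i, q i ∈ rationalPoints L := fun i => Submodule.subset_span ⟨i, rfl⟩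
  have hq : LinearIndependent ℚ q := (linearIndependent_ratVec_iff q).1 hm
  have hq' : LinearIndependent ℚ fun i => (⟨q i, hqL i⟩ : rationalPoints L) := by
    apply LinearIndependent.of_comp (rationalPoints L).subtype
    exact hq
  have hrat : IsRational L := isRational_span_ratVec q
  have hfin : Module.finrank ℚ (rationalPoints L) = r := by
    rw [finrank_rationalPoints hrat, finrank_span_eq_card hm, Fintype.card_fin]
  obtain ⟨b, hb⟩ : ∃ b : Module.Basis (Fin r) ℚ (rationalPoints L),
      ∀ i, (b i : Fin (n + 1) → ℚ) = q i := by
    refine ⟨Module.Basis.mk hq' ?_, fun i => by rw [Module.Basis.mk_apply]⟩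
    rw [hq'.span_eq_top_of_card_eq_finrank' (by simpa using hfin.symm)]
  obtain ⟨c, X, hc, hX, hXL, hXc, hmin⟩ := exists_integerMultivector b
  simp_rw [hb] at hXc
  change X = c • exteriorPower.ιMulti ℝ r (fun i => intVec (m i)) at hXc
  have hne := ιMulti_ne_zero hm
  have hX0 : X ≠ 0 := by
    rw [hXc]
    exact smul_ne_zero hc hne
  have hcX : exteriorPower.ιMulti ℝ r (fun i => intVec (m i)) = c⁻¹ • X := by
    rw [hXc, smul_smul, inv_mul_cancel₀ hc, one_smul]
  refine ⟨hXL ▸ norm_pos_iff.2 hX0, ?_⟩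
  rw [← hXL, hcX]
  exact hmin _ (inv_ne_zero hc) (hcX ▸ ιMulti_intVec_mem m)

/-! ### Reduced bases of lattices -/

section Reduction

variable {V : Type*} [NormedAddCommGroup V] [InnerProductSpace ℝ V]
  {M : Type*} [AddCommGroup M]

lemma map_eq_sum_repr_smul {N : ℕ} (b : Module.Basis (Fin N) ℤ M) (f : M →ₗ[ℤ] V) (x : M) :
    f x = ∑ i, ((b.repr x i : ℤ) : ℝ) • f (b i) := by
  conv_lhs => rw [← b.sum_repr x, map_sum]
  refine Finset.sum_congr rfl fun i _ => ?_
  rw [map_smul, Int.cast_smul_eq_zsmul]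

lemma injective_of_linearIndependent_comp {N : ℕ} (b : Module.Basis (Fin N) ℤ M) (f : M →ₗ[ℤ] V)
    (hf : LinearIndependent ℝ (f ∘ b)) : Function.Injective f := by
  rw [injective_iff_map_eq_zero]
  intro x hx
  rw [map_eq_sum_repr_smul b] at hx
  refine b.ext_elem fun i => ?_
  have h := Fintype.linearIndependent_iff.1 hf _ hx i
  simpa using h

/-- A nonzero lattice has a shortest nonzero vector. -/
lemma exists_shortest_vector {N : ℕ} (b : Module.Basis (Fin (N + 1)) ℤ M) (f : M →ₗ[ℤ] V)
    (hf : LinearIndependent ℝ (f ∘ b)) :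
    ∃ m, m ≠ 0 ∧ ∀ x, x ≠ 0 → ‖f m‖ ≤ ‖f x‖ := by
  -- `V` may be infinite-dimensional; bounded sets contain finitely many lattice points because `f ∘
  -- b` is a basis of `W`.
  let W := Submodule.span ℝ (Set.range (f ∘ b))
  let bW : Module.Basis (Fin (N + 1)) ℝ W := Module.Basis.span hf
  have hW : ∀ x, f x ∈ W := by
    intro x
    rw [map_eq_sum_repr_smul b]
    exact Submodule.sum_mem _ fun i _ => Submodule.smul_mem _ _ (Submodule.subset_span ⟨i, rfl⟩)
  let g : M → W := fun x => ⟨f x, hW x⟩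
  have hg : ∀ x, g x = ∑ i, ((b.repr x i : ℤ) : ℝ) • bW i := by
    intro x
    apply Subtype.ext
    simp only [g, map_eq_sum_repr_smul b f x, AddSubmonoidClass.coe_finsetSum, Submodule.coe_smul]
    refine Finset.sum_congr rfl fun i _ => ?_
    simp only [bW, Module.Basis.span_apply hf, Function.comp_apply]
  have hginj : Function.Injective g := fun x z hxz =>
    injective_of_linearIndependent_comp b f hf (congrArg Subtype.val hxz)
  have hfin : {x : M | x ≠ 0 ∧ ‖f x‖ ≤ ‖f (b 0)‖}.Finite := by
    have : FiniteDimensional ℝ W := bW.finiteDimensional_of_finite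
    have h := ZSpan.setFinite_inter bW
      (Metric.isBounded_closedBall (x := (0 : W)) (r := ‖f (b 0)‖))
    refine (h.preimage hginj.injOn).subset ?_
    rintro x ⟨-, hx⟩
    refine ⟨by simpa [g] using hx, ?_⟩
    rw [SetLike.mem_coe, hg]
    refine Submodule.sum_mem _ fun i _ => ?_
    rw [Int.cast_smul_eq_zsmul]
    exact Submodule.smul_mem _ _ (Submodule.subset_span ⟨i, rfl⟩)
  obtain ⟨m, ⟨hm0, hm⟩, hmin⟩ := Set.exists_min_image _ (fun x => ‖f x‖) hfin
    ⟨b 0, b.ne_zero 0, le_rfl⟩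
  refine ⟨m, hm0, fun x hx => ?_⟩
  rcases le_total ‖f x‖ ‖f (b 0)‖ with h | h
  · exact hmin x ⟨hx, h⟩
  · exact hm.trans h

/-- Lifts of a basis of a quotient by a single vector form a basis together with that vector. -/
lemma exists_basis_cons_of_quotient {N : ℕ} [Module.IsTorsionFree ℤ M] {m : M} (hm : m ≠ 0)
    (b : Module.Basis (Fin N) ℤ (M ⧸ Submodule.span ℤ {m})) (l : Fin N → M)
    (hl : ∀ i, (Submodule.span ℤ {m}).mkQ (l i) = b i) :
    ∃ b' : Module.Basis (Fin (N + 1)) ℤ M, ⇑b' = (Fin.cons m l : Fin (N + 1) → M) := by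
  have hmq : (Submodule.span ℤ {m}).mkQ m = 0 := by
    simp
  refine ⟨Module.Basis.mk (v := (Fin.cons m l : Fin (N + 1) → M)) ?_ ?_, Module.Basis.coe_mk _ _⟩
  · rw [Fintype.linearIndependent_iff]
    intro c hc
    rw [Fin.sum_univ_succ] at hc
    simp only [Fin.cons_zero, Fin.cons_succ] at hc
    have h1 := congrArg (Submodule.span ℤ {m}).mkQ hc
    simp only [map_add, map_smul, hmq, smul_zero, zero_add, map_sum, hl, map_zero] at h1
    have h2 := Fintype.linearIndependent_iff.1 b.linearIndependent _ h1
    simp only [h2, zero_smul, Finset.sum_const_zero, add_zero] at hc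
    have h3 := (smul_eq_zero_iff_left hm).1 hc
    exact Fin.cases h3 h2
  · intro x _
    have h1 : (Submodule.span ℤ {m}).mkQ (x - ∑ i, b.repr ((Submodule.span ℤ {m}).mkQ x) i • l i)
        = 0 := by
      simp only [map_sub, map_sum, map_smul, hl, b.sum_repr, sub_self]
    rw [Submodule.mkQ_apply, Submodule.Quotient.mk_eq_zero] at h1
    rw [← sub_add_cancel x (∑ i, b.repr ((Submodule.span ℤ {m}).mkQ x) i • l i)]
    refine Submodule.add_mem _ ?_ (Submodule.sum_mem _ fun i _ => Submodule.smul_mem _ _ ?_)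
    · refine Submodule.span_mono ?_ h1
      rintro _ rfl
      exact ⟨0, rfl⟩
    · exact Submodule.subset_span ⟨i.succ, rfl⟩

/-- The component of `v` orthogonal to `e`. -/
noncomputable def orthPart (e : V) : V →ₗ[ℝ] V :=
  LinearMap.id - (LinearMap.toSpanSingleton ℝ V e).comp ((‖e‖ ^ 2)⁻¹ • (innerₗ V e))

lemma orthPart_apply (e v : V) : orthPart e v = v - ((‖e‖ ^ 2)⁻¹ * inner ℝ e v) • e := by
  simp [orthPart]

lemma orthPart_self {e : V} (he : e ≠ 0) : orthPart e e = 0 := by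
  have : ‖e‖ ≠ 0 := norm_ne_zero_iff.2 he
  rw [orthPart_apply, real_inner_self_eq_norm_sq, inv_mul_cancel₀ (by positivity), one_smul,
    sub_self]

lemma inner_orthPart {e : V} (he : e ≠ 0) (v : V) : inner ℝ e (orthPart e v) = 0 := by
  have : ‖e‖ ≠ 0 := norm_ne_zero_iff.2 he
  rw [orthPart_apply, inner_sub_right, inner_smul_right, real_inner_self_eq_norm_sq]
  field_simp
  ring

lemma norm_orthPart_add_smul_sq {e : V} (he : e ≠ 0) (v : V) (t : ℝ) :
    ‖orthPart e v + t • e‖ ^ 2 = ‖orthPart e v‖ ^ 2 + t ^ 2 * ‖e‖ ^ 2 := by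
  rw [norm_add_sq_real, inner_smul_right, real_inner_comm, inner_orthPart he, norm_smul, mul_pow,
    Real.norm_eq_abs, sq_abs]
  ring

lemma norm_orthPart_le {e : V} (he : e ≠ 0) (v : V) : ‖orthPart e v‖ ≤ ‖v‖ := by
  have h := norm_orthPart_add_smul_sq he v ((‖e‖ ^ 2)⁻¹ * inner ℝ e v)
  rw [orthPart_apply, sub_add_cancel, ← orthPart_apply] at h
  refine le_of_sq_le_sq ?_ (norm_nonneg _)
  rw [h]
  exact le_add_of_nonneg_right (by positivity)

/-- A shortest nonzero vector of a lattice is primitive. -/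
lemma isTorsionFree_quotient_of_shortest {m : M} {f : M →ₗ[ℤ] V}
    (hf : Function.Injective f) (hm : m ≠ 0) (hmin : ∀ x, x ≠ 0 → ‖f m‖ ≤ ‖f x‖) :
    Module.IsTorsionFree ℤ (M ⧸ Submodule.span ℤ {m}) := by
  have hfm : 0 < ‖f m‖ := norm_pos_iff.2 ((map_ne_zero_iff f hf).2 hm)
  refine Module.IsTorsionFree.of_smul_eq_zero fun k x hkx => ?_
  by_contra! hcon
  obtain ⟨hk, hx⟩ := hcon
  obtain ⟨x, rfl⟩ := Submodule.mkQ_surjective _ x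
  rw [← map_smul, Submodule.mkQ_apply, Submodule.Quotient.mk_eq_zero,
    Submodule.mem_span_singleton] at hkx
  obtain ⟨l, hl⟩ := hkx
  apply hx
  have hkR : (k : ℝ) ≠ 0 := by exact_mod_cast hk
  have h1 : f x = ((l : ℝ) / k) • f m := by
    have h := congrArg f hl
    rw [map_smul, map_smul, ← Int.cast_smul_eq_zsmul ℝ, ← Int.cast_smul_eq_zsmul ℝ] at h
    rw [div_eq_inv_mul, mul_smul, h, smul_smul, inv_mul_cancel₀ hkR, one_smul]
  -- After rounding, the coefficient is at most `1/2` in absolute value; a nonzero difference would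
  -- be shorter than `m`.
  have h2 : f (x - round ((l : ℝ) / k) • m) =
      ((l : ℝ) / k - round ((l : ℝ) / k)) • f m := by
    rw [map_sub, map_smul, h1, sub_smul, Int.cast_smul_eq_zsmul]
  rw [Submodule.mkQ_apply, Submodule.Quotient.mk_eq_zero, Submodule.mem_span_singleton]
  refine ⟨round ((l : ℝ) / k), ?_⟩
  by_contra hne
  have h3 := hmin (x - round ((l : ℝ) / k) • m) (sub_ne_zero.2 (Ne.symm hne))
  rw [h2, norm_smul, Real.norm_eq_abs] at h3
  nlinarith [abs_sub_round ((l : ℝ) / k)]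

end Reduction

/-- Every lattice has a basis which is almost orthogonal and almost ordered by length, up to a
constant depending only on the rank. -/
lemma exists_reduced_basis (V : Type*) [NormedAddCommGroup V] [InnerProductSpace ℝ V] (N : ℕ) :
    ∃ C : ℝ, 1 ≤ C ∧ ∀ (M : Type) [AddCommGroup M] (_ : Module.Basis (Fin N) ℤ M)
      (f : M →ₗ[ℤ] V), (∀ b : Module.Basis (Fin N) ℤ M, LinearIndependent ℝ (f ∘ b)) →
      ∃ b : Module.Basis (Fin N) ℤ M, (∀ i j, i ≤ j → ‖f (b i)‖ ≤ C * ‖f (b j)‖) ∧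
        ∀ (c : Fin N → ℝ) (j), |c j| * ‖f (b j)‖ ≤ C * ‖∑ i, c i • f (b i)‖ := by
  -- The lattice is an abstract `M` with a map to `V`, so that the quotient by a shortest vector,
  -- mapped by projection orthogonally to it, is again an instance.
  induction N with
  | zero => exact ⟨1, le_rfl, fun M _ b₀ f _ => ⟨b₀, fun i => i.elim0, fun c j => j.elim0⟩⟩
  | succ N ih =>
    obtain ⟨C, hC1, hC⟩ := ih
    refine ⟨1 + N * (2 * C) + 2 * C, by nlinarith [(Nat.cast_nonneg N : (0 : ℝ) ≤ N)], ?_⟩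
    intro M _ b₀ f hf
    have : Module.Free ℤ M := Module.Free.of_basis b₀
    have : Module.Finite ℤ M := Module.Finite.of_basis b₀
    obtain ⟨m, hm0, hmin⟩ := exists_shortest_vector b₀ f (hf b₀)
    have hfinj : Function.Injective f := injective_of_linearIndependent_comp b₀ f (hf b₀)
    have : Module.IsTorsionFree ℤ M := inferInstance
    have hli : LinearIndependent ℤ fun _ : Unit => m :=
      Fintype.linearIndependent_iff.2 fun c hc _ => by simpa [hm0] using hc
    set e := f m with he_def
    have he : e ≠ 0 := (map_ne_zero_iff f hfinj).2 hm0
    have hepos : 0 < ‖e‖ := norm_pos_iff.2 he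
    set S := Submodule.span ℤ {m}
    have htf : Module.IsTorsionFree ℤ (M ⧸ S) := isTorsionFree_quotient_of_shortest hfinj hm0 hmin
    have hfree : Module.Free ℤ (M ⧸ S) := inferInstance
    have hrank : Module.finrank ℤ (M ⧸ S) = N := by
      have h1 := Submodule.finrank_quotient_add_finrank S
      have h2 := finrank_span_eq_card hli
      rw [Set.range_const, Fintype.card_unit] at h2
      rw [h2, Module.finrank_eq_card_basis b₀, Fintype.card_fin] at h1
      omega
    let f' : (M ⧸ S) →ₗ[ℤ] V := S.liftQ (((orthPart e).restrictScalars ℤ).comp f) (by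
      rw [Submodule.span_le, Set.singleton_subset_iff]
      exact orthPart_self he)
    have hf' : ∀ x, f' (S.mkQ x) = orthPart e (f x) := fun x => S.liftQ_apply _ x
    -- Size reduction: a lift is changed by a multiple of `m` so that its component along `e` has
    -- coefficient at most `1/2`.
    have hlift : ∀ z : M ⧸ S, ∃ x, S.mkQ x = z ∧ ∃ t : ℝ, |t| ≤ 1 / 2 ∧ f x = f' z + t • e := by
      intro z
      obtain ⟨x, rfl⟩ := S.mkQ_surjective z
      set s := (‖e‖ ^ 2)⁻¹ * inner ℝ e (f x) with hs
      refine ⟨x - round s • m, ?_, s - round s, abs_sub_round s, ?_⟩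
      · rw [map_sub, map_smul, sub_eq_self, ← map_smul, Submodule.mkQ_apply,
          Submodule.Quotient.mk_eq_zero]
        exact Submodule.smul_mem _ _ (Submodule.mem_span_singleton_self m)
      · rw [hf', orthPart_apply, map_sub, map_smul, ← Int.cast_smul_eq_zsmul ℝ, sub_smul]
        abel
    choose lift hlift1 t ht hlift2 using hlift
    have hbasis : ∀ b' : Module.Basis (Fin N) ℤ (M ⧸ S), ∃ b : Module.Basis (Fin (N + 1)) ℤ M,
        b 0 = m ∧ ∀ i, b (Fin.succ i) = lift (b' i) := by
      intro b'
      obtain ⟨b, hb⟩ := exists_basis_cons_of_quotient hm0 b' (fun i => lift (b' i))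
        (fun i => hlift1 _)
      exact ⟨b, by simp [hb], fun i => by simp [hb]⟩
    -- A relation between projections becomes one between lifts once a suitable multiple of `e` is
    -- subtracted.
    have hind : ∀ b' : Module.Basis (Fin N) ℤ (M ⧸ S), LinearIndependent ℝ (f' ∘ b') := by
      intro b'
      obtain ⟨b, hb0, hb⟩ := hbasis b'
      rw [Fintype.linearIndependent_iff]
      intro c hc i
      have h1 := Fintype.linearIndependent_iff.1 (hf b)
        (Fin.cons (-∑ i, c i * t (b' i)) c) ?_ i.succ
      · simpa using h1
      · rw [Fin.sum_univ_succ]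
        simp only [Fin.cons_zero, Fin.cons_succ, Function.comp_apply, hb0, hb, hlift2, smul_add,
          Finset.sum_add_distrib]
        simp only [Function.comp_apply] at hc
        rw [hc, zero_add, neg_smul, Finset.sum_smul]
        simp [mul_smul, he_def]
    obtain ⟨b', hb1, hb2⟩ := hC (M ⧸ S) (Module.finBasisOfFinrankEq ℤ _ hrank) f' hind
    obtain ⟨b, hb0, hb⟩ := hbasis b'
    -- Since `e` is shortest, `‖f b_j‖² ≤ ‖f' b'_j‖² + ‖f b_j‖² / 4`: lifting at most doubles
    -- lengths.
    have hB : ∀ j : Fin N, ‖f (b j.succ)‖ ≤ 2 * ‖f' (b' j)‖ := by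
      intro j
      have h1 : ‖e‖ ≤ ‖f (b j.succ)‖ := hmin _ (b.ne_zero _)
      obtain ⟨x, hx⟩ := S.mkQ_surjective (b' j)
      have h2 : ‖f (b j.succ)‖ ^ 2 = ‖f' (b' j)‖ ^ 2 + t (b' j) ^ 2 * ‖e‖ ^ 2 := by
        rw [hb, hlift2, ← hx, hf', norm_orthPart_add_smul_sq he]
      have h3 : t (b' j) ^ 2 ≤ 1 / 4 := by
        have := abs_le.1 (ht (b' j))
        nlinarith
      have h4 : ‖e‖ ^ 2 ≤ ‖f (b j.succ)‖ ^ 2 := by gcongr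
      refine le_of_sq_le_sq ?_ (by positivity)
      nlinarith [mul_le_mul_of_nonneg_right h3 (sq_nonneg ‖e‖)]
    have hB' : ∀ j : Fin N, ‖f' (b' j)‖ ≤ ‖f (b j.succ)‖ := by
      intro j
      have h : f' (b' j) = orthPart e (f (b j.succ)) := by
        rw [← hf', hb, hlift1]
      rw [h]
      exact norm_orthPart_le he _
    have hN : (0 : ℝ) ≤ N := Nat.cast_nonneg N
    have hNC : 0 ≤ (N : ℝ) * (2 * C) := by positivity
    refine ⟨b, ?_, ?_⟩
    · intro i j hij
      induction j using Fin.cases with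
      | zero =>
        obtain rfl : i = 0 := by simpa using hij
        nlinarith [norm_nonneg (f (b 0))]
      | succ j =>
        induction i using Fin.cases with
        | zero =>
          have := hmin _ (b.ne_zero j.succ)
          rw [hb0]
          nlinarith [norm_nonneg (f (b j.succ))]
        | succ i =>
          have h1 := hb1 i j (by simpa using hij)
          calc ‖f (b i.succ)‖ ≤ 2 * ‖f' (b' i)‖ := hB i
            _ ≤ 2 * (C * ‖f (b j.succ)‖) := by
              gcongr
              exact h1.trans (by gcongr; exact hB' j)
            _ ≤ _ := by nlinarith [norm_nonneg (f (b j.succ))]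
    · intro c
      set x := ∑ i, c i • f (b i) with hx
      -- Projecting `x` kills the `e` term and does not increase the norm, so the induction
      -- hypothesis applies.
      have hsucc : ∀ j : Fin N, |c j.succ| * ‖f (b j.succ)‖ ≤ 2 * C * ‖x‖ := by
        intro j
        have h1 := hb2 (fun j => c j.succ) j
        have h2 : ∑ i : Fin N, c i.succ • f' (b' i) = orthPart e x := by
          rw [hx, Fin.sum_univ_succ, map_add, map_smul, hb0, orthPart_self he, smul_zero, zero_add,
            map_sum]
          refine Finset.sum_congr rfl fun i _ => ?_
          rw [map_smul, ← hf', hb, hlift1]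
        rw [h2] at h1
        calc |c j.succ| * ‖f (b j.succ)‖ ≤ |c j.succ| * (2 * ‖f' (b' j)‖) := by
              gcongr
              exact hB j
          _ = 2 * (|c j.succ| * ‖f' (b' j)‖) := by ring
          _ ≤ 2 * (C * ‖x‖) := by
              have := mul_le_mul_of_nonneg_left (norm_orthPart_le he x) (zero_le_one.trans hC1)
              linarith
          _ = _ := by ring
      intro j
      induction j using Fin.cases with
      | zero =>
        -- The coefficient of `e` is controlled by difference, which costs the term `N * (2 * C)` in
        -- the constant.
        have h1 : c 0 • f (b 0) = x - ∑ j : Fin N, c j.succ • f (b j.succ) := by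
          rw [hx, Fin.sum_univ_succ, add_sub_cancel_right]
        have h2 : ‖∑ j : Fin N, c j.succ • f (b j.succ)‖ ≤ N * (2 * C * ‖x‖) := by
          refine (norm_sum_le _ _).trans ?_
          refine (Finset.sum_le_card_nsmul _ _ (2 * C * ‖x‖) fun j _ => ?_).trans (by simp)
          rw [norm_smul, Real.norm_eq_abs]
          exact hsucc j
        rw [← Real.norm_eq_abs, ← norm_smul, h1]
        refine (norm_sub_le _ _).trans ?_
        nlinarith [norm_nonneg x]
      | succ j =>
        refine (hsucc j).trans ?_
        gcongr
        linarith

/-! ### Comparison of norms with coordinates in an adapted basis -/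

lemma exists_basis_zero_eq {n : ℕ} {y : E n} (hy : y ≠ 0) :
    ∃ F : Module.Basis (Fin (n + 1)) ℝ (E n), F 0 = y := by
  have hy' : ‖y‖ ≠ 0 := norm_ne_zero_iff.2 hy
  obtain ⟨b, hb⟩ := Orthonormal.exists_orthonormalBasis_extension_of_card_eq (𝕜 := ℝ)
    (E := E n) (ι := Fin (n + 1)) (by simp) (v := fun _ => ‖y‖⁻¹ • y) (s := {0}) (by
      refine ⟨fun i => ?_, fun i j hij => (hij (Subsingleton.elim i j)).elim⟩
      simp only [Set.domRestrict_apply]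
      rw [norm_smul, norm_inv, norm_norm, inv_mul_cancel₀ hy'])
  refine ⟨b.toBasis.unitsSMul fun _ => Units.mk0 ‖y‖ hy', ?_⟩
  rw [Module.Basis.unitsSMul_apply, OrthonormalBasis.coe_toBasis, hb 0 rfl, Units.smul_def,
    Units.val_mk0, smul_smul, mul_inv_cancel₀ hy', one_smul]

/-- Pair with `F_0^* ∧ F_I^*`: on `F_0 ∧ v_1 ∧ ⋯ ∧ v_r` the first row of the determinant is `(1, 0,
…, 0)`, as `0 ∉ I`, leaving the minor of index `I`. -/
lemma exists_functional_wedge {n r : ℕ} (F : Module.Basis (Fin (n + 1)) ℝ (E n))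
    (I : Set.powersetCard (Fin (n + 1)) r) (hI : 0 ∉ I) :
    ∃ l : ⋀[ℝ]^(r + 1) (E n) →ₗ[ℝ] ℝ,
      ∀ X, l (wedge (F 0) X) = (F.exteriorPower r).repr X I := by
  let σ := Set.powersetCard.ofFinEmbEquiv.symm I
  have hσ : ∀ k, σ k ≠ 0 := by
    intro k hk
    exact hI ((Set.powersetCard.mem_range_ofFinEmbEquiv_symm_iff_mem I 0).1 ⟨k, hk⟩)
  let l : ⋀[ℝ]^(r + 1) (E n) →ₗ[ℝ] ℝ := exteriorPower.pairingDual ℝ (E n) (r + 1)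
    (exteriorPower.ιMulti ℝ (r + 1) (Fin.cons (F.coord 0) fun k => F.coord (σ k)))
  let wl : ⋀[ℝ]^r (E n) →ₗ[ℝ] ⋀[ℝ]^(r + 1) (E n) :=
    { toFun := wedge (F 0), map_add' := wedge_add _, map_smul' := wedge_smul _ }
  refine ⟨l, fun X => ?_⟩
  have h : l.comp wl = (F.exteriorPower r).coord I := by
    rw [exteriorPower.basis_coord]
    apply exteriorPower.linearMap_ext
    ext v
    simp only [LinearMap.compAlternatingMap_apply, LinearMap.comp_apply,
      exteriorPower.ιMultiDual_apply_ιMulti]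
    change l (wedge (F 0) _) = _
    rw [wedge_ιMulti]
    simp only [l, exteriorPower.pairingDual_ιMulti_ιMulti]
    rw [Matrix.det_succ_row_zero, Fin.sum_univ_succ, Finset.sum_eq_zero]
    · have hs : Matrix.submatrix (Matrix.of fun i j : Fin (r + 1) =>
          (Fin.cons (F.coord 0) (fun k => F.coord (σ k)) : Fin (r + 1) → Module.Dual ℝ (E n)) j
            ((Fin.cons (F 0) v : Fin (r + 1) → E n) i)) Fin.succ (Fin.succAbove 0) =
          Matrix.of fun i j => F.coord (σ j) (v i) := by
        ext i j
        simp
      rw [hs]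
      simp [σ]
    · intro k _
      have : F.coord (σ k) (F 0) = 0 := by
        rw [Module.Basis.coord_apply, Module.Basis.repr_self, Finsupp.single_eq_of_ne (hσ k)]
      simp [this]
  exact LinearMap.congr_fun h X

/-- Wedging with `F 0` kills exactly the basis multivectors with `0 ∈ I`, so `‖wedge (F 0) X‖` is
comparable to the largest of the other coordinates. -/
lemma exists_comparison {n : ℕ} (r : ℕ) (F : Module.Basis (Fin (n + 1)) ℝ (E n)) :
    ∃ K : ℝ, 0 < K ∧ ∀ X : ⋀[ℝ]^r (E n),
      (∀ I, |(F.exteriorPower r).repr X I| ≤ K * ‖X‖) ∧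
      (∀ I, 0 ∉ I → |(F.exteriorPower r).repr X I| ≤ K * ‖wedge (F 0) X‖) ∧
      (∀ t, 0 ≤ t → (∀ I, |(F.exteriorPower r).repr X I| ≤ t) → ‖X‖ ≤ K * t) ∧
      (∀ t, 0 ≤ t → (∀ I, 0 ∉ I → |(F.exteriorPower r).repr X I| ≤ t) →
        ‖wedge (F 0) X‖ ≤ K * t) := by
  have hl : ∀ I : Set.powersetCard (Fin (n + 1)) r, ∃ l : ⋀[ℝ]^(r + 1) (E n) →ₗ[ℝ] ℝ,
      0 ∉ I → ∀ X, l (wedge (F 0) X) = (F.exteriorPower r).repr X I := by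
    intro I
    by_cases hI : 0 ∈ I
    · exact ⟨0, fun h => (h hI).elim⟩
    · obtain ⟨l, hl⟩ := exists_functional_wedge F I hI
      exact ⟨l, fun _ => hl⟩
  choose l hl using hl
  set k₁ : Set.powersetCard (Fin (n + 1)) r → ℝ := fun I =>
    ‖LinearMap.toContinuousLinearMap ((F.exteriorPower r).coord I)‖
  set k₂ : Set.powersetCard (Fin (n + 1)) r → ℝ := fun I =>
    ‖LinearMap.toContinuousLinearMap (l I)‖
  set k₃ := ∑ I, ‖F.exteriorPower r I‖
  set k₄ := ∑ I, ‖wedge (F 0) (F.exteriorPower r I)‖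
  have h1 : 0 ≤ ∑ I, k₁ I := Finset.sum_nonneg fun I _ => by positivity
  have h2 : 0 ≤ ∑ I, k₂ I := Finset.sum_nonneg fun I _ => by positivity
  have h3 : 0 ≤ k₃ := Finset.sum_nonneg fun I _ => norm_nonneg _
  have h4 : 0 ≤ k₄ := Finset.sum_nonneg fun I _ => norm_nonneg _
  have hX4 : ∀ X, wedge (F 0) X =
      ∑ I, (F.exteriorPower r).repr X I • wedge (F 0) (F.exteriorPower r I) := by
    intro X
    let wl : ⋀[ℝ]^r (E n) →ₗ[ℝ] ⋀[ℝ]^(r + 1) (E n) :=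
      { toFun := wedge (F 0), map_add' := wedge_add _, map_smul' := wedge_smul _ }
    have h := congrArg wl ((F.exteriorPower r).sum_repr X)
    rw [map_sum] at h
    simp only [map_smul] at h
    exact h.symm
  refine ⟨∑ I, k₁ I + ∑ I, k₂ I + k₃ + k₄ + 1, by linarith, fun X => ⟨fun I => ?_, fun I hI => ?_,
    fun t ht hX => ?_, fun t ht hX => ?_⟩⟩
  · refine ((LinearMap.toContinuousLinearMap ((F.exteriorPower r).coord I)).le_opNorm X).trans ?_
    gcongr
    have := Finset.single_le_sum (f := k₁) (fun _ _ => by positivity) (Finset.mem_univ I)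
    linarith
  · rw [← hl I hI X]
    refine ((LinearMap.toContinuousLinearMap (l I)).le_opNorm (wedge (F 0) X)).trans ?_
    gcongr
    have := Finset.single_le_sum (f := k₂) (fun _ _ => by positivity) (Finset.mem_univ I)
    linarith
  · have h : ‖X‖ ≤ k₃ * t := by
      conv_lhs => rw [← (F.exteriorPower r).sum_repr X]
      refine (norm_sum_le _ _).trans ?_
      rw [Finset.sum_mul]
      refine Finset.sum_le_sum fun I _ => ?_
      rw [norm_smul, mul_comm]
      gcongr
      exact hX I
    exact h.trans (by gcongr; linarith)
  · have h : ‖wedge (F 0) X‖ ≤ k₄ * t := by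
      rw [hX4]
      refine (norm_sum_le _ _).trans ?_
      rw [Finset.sum_mul]
      refine Finset.sum_le_sum fun I _ => ?_
      by_cases hI : 0 ∈ I
      · have h0 : wedge (F 0) (F.exteriorPower r I) = 0 := by
          rw [exteriorPower.basis_apply, exteriorPower.ιMulti_family]
          obtain ⟨k, hk⟩ := (Set.powersetCard.mem_range_ofFinEmbEquiv_symm_iff_mem I 0).2 hI
          exact wedge_ιMulti_of_mem_span (Submodule.subset_span ⟨k, by simp [hk]⟩)
        rw [h0, smul_zero, norm_zero, zero_mul]
      · rw [norm_smul, mul_comm]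
        gcongr
        exact hX I hI
    exact h.trans (by gcongr; linarith)

/-! ### Short decomposable integer multivectors -/

/-- Every term of the Leibniz expansion has the same bound. -/
lemma abs_det_le {r : ℕ} (A : Matrix (Fin r) (Fin r) ℝ) (α β : Fin r → ℝ)
    (h : ∀ i j, |A i j| ≤ α i * β j) :
    |A.det| ≤ r.factorial * ((∏ i, α i) * ∏ j, β j) := by
  rw [Matrix.det_apply']
  refine (Finset.abs_sum_le_sum_abs _ _).trans ?_
  refine (Finset.sum_le_card_nsmul _ _ ((∏ i, α i) * ∏ j, β j) fun σ _ => ?_).trans ?_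
  · have hσ : |((Equiv.Perm.sign σ : ℤ) : ℝ)| = 1 := by
      rcases Int.units_eq_one_or (Equiv.Perm.sign σ) with h | h <;> simp [h]
    rw [abs_mul, hσ, one_mul, Finset.abs_prod, ← Equiv.prod_comp σ α, ← Finset.prod_mul_distrib]
    exact Finset.prod_le_prod (fun _ _ => abs_nonneg _) fun i _ => h _ _
  · simp [Fintype.card_perm]

lemma le_of_strictMono_fin {r N : ℕ} (hr : r ≤ N) (J : Fin r ↪o Fin N) (k : Fin r) :
    Fin.castLE hr k ≤ J k := by
  obtain ⟨k, hk⟩ := k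
  induction k with
  | zero => simp [Fin.le_def]
  | succ k ih =>
    have h1 := ih (by omega)
    have h2 : J ⟨k, by omega⟩ < J ⟨k + 1, hk⟩ := J.strictMono (by simp [Fin.lt_def])
    simp only [Fin.le_def, Fin.lt_def, Fin.val_castLE] at *
    omega

/-- `intVec` as a linear map. -/
noncomputable def intVecLinear (n : ℕ) : (Fin (n + 1) → ℤ) →ₗ[ℤ] E n :=
  AddMonoidHom.toIntLinearMap
    { toFun := intVec
      map_zero' := by ext; simp [intVec, ratVec]
      map_add' := fun _ _ => by ext; simp [intVec, ratVec] }

lemma intVec_eq_sum {n N : ℕ} (b : Module.Basis (Fin N) ℤ (Fin (n + 1) → ℤ))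
    (m : Fin (n + 1) → ℤ) : intVec m = ∑ j, ((b.repr m j : ℤ) : ℝ) • intVec (b j) :=
  map_eq_sum_repr_smul b (intVecLinear n) m

lemma intVec_single {n : ℕ} (i : Fin (n + 1)) :
    intVec (Pi.single i 1) = EuclideanSpace.basisFun (Fin (n + 1)) ℝ i := by
  ext j
  by_cases h : j = i
  · subst h; simp [intVec, ratVec]
  · simp [intVec, ratVec, h]

lemma exists_real_basis {n : ℕ} (b : Module.Basis (Fin (n + 1)) ℤ (Fin (n + 1) → ℤ)) :
    ∃ B : Module.Basis (Fin (n + 1)) ℝ (E n), (∀ j, B j = intVec (b j)) ∧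
      ∀ m j, B.repr (intVec m) j = (b.repr m j : ℤ) := by
  have hspan : ⊤ ≤ Submodule.span ℝ (Set.range fun j => intVec (b j)) := by
    rw [← (EuclideanSpace.basisFun (Fin (n + 1)) ℝ).toBasis.span_eq, Submodule.span_le]
    rintro _ ⟨i, rfl⟩
    rw [OrthonormalBasis.coe_toBasis, ← intVec_single, intVec_eq_sum b]
    exact Submodule.sum_mem _ fun j _ => Submodule.smul_mem _ _ (Submodule.subset_span ⟨j, rfl⟩)
  have hli := linearIndependent_of_top_le_span_of_card_eq_finrank hspan (by simp)
  obtain ⟨B, hB⟩ : ∃ B : Module.Basis (Fin (n + 1)) ℝ (E n), ∀ j, B j = intVec (b j) :=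
    ⟨Module.Basis.mk hli hspan, fun j => by rw [Module.Basis.mk_apply]⟩
  refine ⟨B, hB, fun m j => ?_⟩
  rw [intVec_eq_sum b]
  simp only [← hB]
  rw [Module.Basis.repr_sum_self]

/-- The canonical vectors have integer coordinates in `B`, so the coordinates of their wedges are
integer minors. -/
lemma exists_int_repr {n r : ℕ} (b : Module.Basis (Fin (n + 1)) ℤ (Fin (n + 1) → ℤ))
    {B : Module.Basis (Fin (n + 1)) ℝ (E n)} (hB : ∀ m j, B.repr (intVec m) j = (b.repr m j : ℤ))
    {X : ⋀[ℝ]^r (E n)} (hX : X ∈ integerMultivectors n r)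
    (J : Set.powersetCard (Fin (n + 1)) r) :
    ∃ k : ℤ, (k : ℝ) = (B.exteriorPower r).repr X J := by
  induction hX using Submodule.span_induction with
  | mem x hx =>
    obtain ⟨s, rfl⟩ := hx
    rw [exteriorPower.basis_apply, exteriorPower.ιMulti_family, exteriorPower.basis_repr_apply,
      exteriorPower.ιMultiDual_apply_ιMulti]
    refine ⟨(Matrix.of fun i j => b.repr (Pi.single (Set.powersetCard.ofFinEmbEquiv.symm s i) 1)
      (Set.powersetCard.ofFinEmbEquiv.symm J j)).det, ?_⟩
    rw [← eq_intCast (Int.castRingHom ℝ), RingHom.map_det]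
    congr 1
    ext i j
    have h := hB (Pi.single (Set.powersetCard.ofFinEmbEquiv.symm s i) 1)
      (Set.powersetCard.ofFinEmbEquiv.symm J j)
    rw [intVec_single] at h
    simpa using h.symm
  | zero => exact ⟨0, by simp⟩
  | add x y _ _ hx hy =>
    obtain ⟨k, hk⟩ := hx
    obtain ⟨l, hl⟩ := hy
    exact ⟨k + l, by simp [hk, hl]⟩
  | smul c x _ hx =>
    obtain ⟨k, hk⟩ := hx
    refine ⟨c * k, ?_⟩
    rw [← Int.cast_smul_eq_zsmul ℝ, map_smul, Finsupp.smul_apply, ← hk]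
    simp

/-- The product of the weights of the elements of `I`. -/
noncomputable def weight {N r : ℕ} (w : Fin N → ℝ) (I : Set.powersetCard (Fin N) r) : ℝ :=
  ∏ k, w (Set.powersetCard.ofFinEmbEquiv.symm I k)

/-- Coordinates in `F`, scaled by weights. -/
noncomputable def scaledCoord {n : ℕ} (F : Module.Basis (Fin (n + 1)) ℝ (E n))
    (w : Fin (n + 1) → ℝ) : E n →ₗ[ℝ] E n :=
  (WithLp.linearEquiv 2 ℝ (Fin (n + 1) → ℝ)).symm.toLinearMap.comp
    (LinearMap.pi fun i => w i • F.coord i)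

lemma scaledCoord_apply {n : ℕ} (F : Module.Basis (Fin (n + 1)) ℝ (E n))
    (w : Fin (n + 1) → ℝ) (x : E n) (i : Fin (n + 1)) :
    scaledCoord F w x i = w i * F.repr x i := by
  simp [scaledCoord]

lemma scaledCoord_injective {n : ℕ} (F : Module.Basis (Fin (n + 1)) ℝ (E n))
    {w : Fin (n + 1) → ℝ} (hw : ∀ i, 0 < w i) : Function.Injective (scaledCoord F w) := by
  rw [injective_iff_map_eq_zero]
  intro x hx
  refine F.ext_elem fun i => ?_
  have h := congrArg (fun z : E n => z i) hx
  simp only [scaledCoord_apply] at h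
  simpa [(hw i).ne'] using h

lemma norm_scaledCoord_basis {n : ℕ} (F : Module.Basis (Fin (n + 1)) ℝ (E n))
    {w : Fin (n + 1) → ℝ} (hw : ∀ i, 0 < w i) (i : Fin (n + 1)) :
    ‖scaledCoord F w (F i)‖ = w i := by
  have : scaledCoord F w (F i) = EuclideanSpace.single i (w i) := by
    ext j
    rw [scaledCoord_apply, Module.Basis.repr_self]
    by_cases h : j = i
    · subst h; simp
    · simp [h, Finsupp.single_eq_of_ne h]
  rw [this, PiLp.norm_single, Real.norm_of_nonneg (hw i).le]

lemma abs_repr_mul_le {n : ℕ} (F : Module.Basis (Fin (n + 1)) ℝ (E n))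
    {w : Fin (n + 1) → ℝ} (hw : ∀ i, 0 < w i) (x : E n) (i : Fin (n + 1)) :
    |F.repr x i| * w i ≤ ‖scaledCoord F w x‖ := by
  have h := PiLp.norm_apply_le (scaledCoord F w x) i
  rwa [scaledCoord_apply, norm_mul, Real.norm_of_nonneg (hw i).le, mul_comm] at h

/-- An integer multivector with small weighted coordinates gives rise to a decomposable one. -/
lemma exists_decomposable {n r : ℕ} (hr : r ≤ n + 1) (F : Module.Basis (Fin (n + 1)) ℝ (E n)) :
    ∃ C : ℝ, 0 < C ∧ ∀ w : Fin (n + 1) → ℝ, (∀ i, 0 < w i) →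
      ∀ X ∈ integerMultivectors n r, X ≠ 0 →
      ∀ K, (∀ I, |(F.exteriorPower r).repr X I| * weight w I ≤ K) →
      ∃ m : Fin r → Fin (n + 1) → ℤ, LinearIndependent ℝ (fun i => intVec (m i)) ∧
        ∀ I, |(F.exteriorPower r).repr (exteriorPower.ιMulti ℝ r fun i => intVec (m i)) I| *
          weight w I ≤ C * K := by
  obtain ⟨C, hC1, hC⟩ := exists_reduced_basis (E n) (n + 1)
  have hC0 : 0 < C := zero_lt_one.trans_le hC1
  refine ⟨r.factorial * (C ^ r *
    (Fintype.card (Set.powersetCard (Fin (n + 1)) r) * (r.factorial * C ^ r)) + 1), by positivity, ?_⟩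
  intro w hw X hX hX0 K hK
  set T := scaledCoord F w
  have hTinj : Function.Injective T := scaledCoord_injective F hw
  obtain ⟨b, hb1, hb2⟩ := hC (Fin (n + 1) → ℤ) (Pi.basisFun ℤ _)
    ((T.restrictScalars ℤ).comp (intVecLinear n)) (by
      intro b
      obtain ⟨B, hB, -⟩ := exists_real_basis b
      have h := B.linearIndependent.map' T (LinearMap.ker_eq_bot.2 hTinj)
      have e : (T ∘ B) = ⇑((T.restrictScalars ℤ).comp (intVecLinear n)) ∘ b := by
        funext j
        simp only [Function.comp_apply, hB]
        rfl
      rwa [e] at h)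
  obtain ⟨B, hB, hBrepr⟩ := exists_real_basis b
  have hf : ∀ j, ((T.restrictScalars ℤ).comp (intVecLinear n)) (b j) = T (B j) := by
    intro j
    rw [hB]
    rfl
  simp only [hf] at hb1 hb2
  set p : Fin (n + 1) → ℝ := fun j => ‖T (B j)‖
  have hp : ∀ j, 0 < p j := fun j =>
    norm_pos_iff.2 ((map_ne_zero_iff T hTinj).2 (B.ne_zero j))
  -- Almost orthogonality applied to `T (F i)`, whose norm is `w i`.
  have hcoef : ∀ i j, |B.repr (F i) j| ≤ (C * w i) * (p j)⁻¹ := by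
    intro i j
    have h := hb2 (fun k => B.repr (F i) k) j
    simp_rw [← map_smul, ← map_sum, B.sum_repr] at h
    rw [norm_scaledCoord_basis F hw] at h
    rwa [← div_eq_mul_inv, le_div_iff₀ (hp j)]
  obtain ⟨J, hJ⟩ : ∃ J, (B.exteriorPower r).repr X J ≠ 0 := by
    by_contra! h
    exact hX0 ((B.exteriorPower r).ext_elem (by simpa using h))
  have hJ1 : 1 ≤ |(B.exteriorPower r).repr X J| := by
    obtain ⟨k, hk⟩ := exists_int_repr b hBrepr hX J
    rw [← hk] at hJ ⊢
    exact_mod_cast Int.one_le_abs (by exact_mod_cast hJ)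
  set N : ℝ := (Fintype.card (Set.powersetCard (Fin (n + 1)) r) : ℝ) with hN
  have hwpos : ∀ I : Set.powersetCard (Fin (n + 1)) r, 0 < weight w I := fun I =>
    Finset.prod_pos fun k _ => hw _
  have hppos : 0 < weight p J := Finset.prod_pos fun k _ => hp _
  have hsum : (B.exteriorPower r).repr X J = ∑ I, (F.exteriorPower r).repr X I *
      (Matrix.of fun i j => B.coord (Set.powersetCard.ofFinEmbEquiv.symm J j)
        (F (Set.powersetCard.ofFinEmbEquiv.symm I i))).det := by
    conv_lhs => rw [← (F.exteriorPower r).sum_repr X]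
    rw [exteriorPower.basis_repr_apply, map_sum]
    refine Finset.sum_congr rfl fun I _ => ?_
    rw [map_smul, smul_eq_mul, exteriorPower.basis_apply, exteriorPower.ιMulti_family,
      exteriorPower.ιMultiDual_apply_ιMulti]
    rfl
  -- The nonzero integer coordinate of index `J` is at least `1` in absolute value and at most `≪ K
  -- / weight p J`.
  have hbound : weight p J ≤ N * (r.factorial * C ^ r) * K := by
    have h1 : |(B.exteriorPower r).repr X J| ≤
        N * (r.factorial * C ^ r * (weight p J)⁻¹ * K) := by
      rw [hsum]
      refine (Finset.abs_sum_le_sum_abs _ _).trans ?_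
      refine (Finset.sum_le_card_nsmul _ _
        (r.factorial * C ^ r * (weight p J)⁻¹ * K) fun I _ => ?_).trans (by simp [hN])
      have h2 := abs_det_le (Matrix.of fun i j => B.coord (Set.powersetCard.ofFinEmbEquiv.symm J j)
        (F (Set.powersetCard.ofFinEmbEquiv.symm I i)))
        (fun i => C * w (Set.powersetCard.ofFinEmbEquiv.symm I i))
        (fun j => (p (Set.powersetCard.ofFinEmbEquiv.symm J j))⁻¹) (fun i j => hcoef _ _)
      rw [Finset.prod_mul_distrib, Finset.prod_const, Finset.card_univ, Fintype.card_fin,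
        Finset.prod_inv_distrib] at h2
      change _ ≤ (r.factorial : ℝ) * (C ^ r * weight w I * (weight p J)⁻¹) at h2
      rw [abs_mul]
      calc _ ≤ |(F.exteriorPower r).repr X I| *
            ((r.factorial : ℝ) * (C ^ r * weight w I * (weight p J)⁻¹)) := by gcongr
        _ = (r.factorial : ℝ) * C ^ r * (weight p J)⁻¹ *
            (|(F.exteriorPower r).repr X I| * weight w I) := by ring
        _ ≤ _ := by
          gcongr
          exact hK I
    have h3 := hJ1.trans h1
    calc weight p J = weight p J * 1 := (mul_one _).symm
      _ ≤ weight p J * (N * (r.factorial * C ^ r * (weight p J)⁻¹ * K)) := by gcongr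
      _ = _ := by field_simp
  have hK0 : 0 ≤ K := (mul_nonneg (abs_nonneg _) (hwpos J).le).trans (hK J)
  -- The first `r` vectors of the reduced basis; the `k`-th element of `J` is at least `k`, so their
  -- lengths are at most `C` times those indexed by `J`.
  refine ⟨fun k => b (Fin.castLE hr k), ?_, fun I => ?_⟩
  · have h := B.linearIndependent.comp (Fin.castLE hr) (Fin.castLE_injective hr)
    convert! h using 1
    funext k
    exact (hB _).symm
  · rw [exteriorPower.basis_repr_apply, exteriorPower.ιMultiDual_apply_ιMulti]
    have h1 := abs_det_le (Matrix.of fun i j => F.coord (Set.powersetCard.ofFinEmbEquiv.symm I j)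
        (intVec (b (Fin.castLE hr i))))
        (fun i => p (Fin.castLE hr i))
        (fun j => (w (Set.powersetCard.ofFinEmbEquiv.symm I j))⁻¹) (fun i j => by
          rw [← div_eq_mul_inv, le_div_iff₀ (hw _)]
          change |F.repr (intVec (b (Fin.castLE hr i))) _| * _ ≤ ‖T (B (Fin.castLE hr i))‖
          rw [← hB]
          exact abs_repr_mul_le F hw _ _)
    rw [Finset.prod_inv_distrib] at h1
    have h2 : ∏ i, p (Fin.castLE hr i) ≤ C ^ r * weight p J := by
      have : ∏ i, p (Fin.castLE hr i) ≤
          ∏ i, (C * p (Set.powersetCard.ofFinEmbEquiv.symm J i)) :=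
        Finset.prod_le_prod (fun i _ => (hp _).le)
          fun i _ => hb1 _ _ (le_of_strictMono_fin hr _ i)
      rwa [Finset.prod_mul_distrib, Finset.prod_const, Finset.card_univ, Fintype.card_fin] at this
    change _ ≤ (r.factorial : ℝ) * ((∏ i, p (Fin.castLE hr i)) * (weight w I)⁻¹) at h1
    calc _ ≤ (r.factorial : ℝ) * ((∏ i, p (Fin.castLE hr i)) * (weight w I)⁻¹) * weight w I := by
          gcongr
          exact (hwpos I).le
      _ = (r.factorial : ℝ) * ∏ i, p (Fin.castLE hr i) := by
          have := (hwpos I).ne'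
          field_simp
      _ ≤ (r.factorial : ℝ) * (C ^ r * (N * (r.factorial * C ^ r) * K)) := by
          gcongr
          exact h2.trans (by gcongr)
      _ ≤ _ := by
          have : 0 ≤ (r.factorial : ℝ) * K := by positivity
          linear_combination this

lemma weight_of_notMem {n r : ℕ} (α β : ℝ) {I : Set.powersetCard (Fin (n + 1)) r}
    (hI : 0 ∉ I) : weight (Fin.cons α fun _ => β : Fin (n + 1) → ℝ) I = β ^ r := by
  rw [weight, Finset.prod_eq_pow_card (b := β), Finset.card_univ, Fintype.card_fin]
  intro k _
  obtain ⟨i, hi⟩ := Fin.exists_succ_eq.2 (fun h => hI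
    ((Set.powersetCard.mem_range_ofFinEmbEquiv_symm_iff_mem I 0).1 ⟨k, h⟩))
  rw [← hi, Fin.cons_succ]

lemma weight_of_mem {n s : ℕ} (α β : ℝ) {I : Set.powersetCard (Fin (n + 1)) (s + 1)}
    (hI : 0 ∈ I) : weight (Fin.cons α fun _ => β : Fin (n + 1) → ℝ) I = α * β ^ s := by
  obtain ⟨k, hk⟩ := (Set.powersetCard.mem_range_ofFinEmbEquiv_symm_iff_mem I 0).2 hI
  rw [weight, ← Finset.mul_prod_erase _ _ (Finset.mem_univ k), hk, Fin.cons_zero,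
    Finset.prod_eq_pow_card (b := β), Finset.card_erase_of_mem (Finset.mem_univ k),
    Finset.card_univ, Fintype.card_fin, Nat.add_sub_cancel]
  intro l hl
  have hne : Set.powersetCard.ofFinEmbEquiv.symm I l ≠ 0 := by
    rw [← hk]
    exact fun h => (Finset.mem_erase.1 hl).1 ((Set.powersetCard.ofFinEmbEquiv.symm I).injective h)
  obtain ⟨i, hi⟩ := Fin.exists_succ_eq.2 hne
  rw [← hi, Fin.cons_succ]

/-- Up to a constant, the smallest values of `‖X‖` and `‖y ∧ X‖` on integer multivectors are
attained on decomposable ones. -/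
lemma exists_decomposable_le {n s : ℕ} (hs : s ≤ n) {y : E n} (hy : y ≠ 0) :
    ∃ C : ℝ, 0 < C ∧ ∀ X ∈ integerMultivectors n (s + 1), X ≠ 0 → ∀ Q ε : ℝ, 0 < ε → ε ≤ Q →
      ‖X‖ ≤ Q → ‖wedge y X‖ ≤ ε →
      ∃ m : Fin (s + 1) → Fin (n + 1) → ℤ, LinearIndependent ℝ (fun i => intVec (m i)) ∧
        ‖exteriorPower.ιMulti ℝ (s + 1) fun i => intVec (m i)‖ ≤ C * Q ∧
        ‖wedge y (exteriorPower.ιMulti ℝ (s + 1) fun i => intVec (m i))‖ ≤ C * ε := by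
  obtain ⟨F, rfl⟩ := exists_basis_zero_eq hy
  obtain ⟨K, hK0, hK⟩ := exists_comparison (s + 1) F
  obtain ⟨C, hC0, hC⟩ := exists_decomposable (r := s + 1) (by omega) F
  refine ⟨K * (C * K), by positivity, fun X hX hX0 Q ε hε hεQ hXQ hXε => ?_⟩
  have hQ : 0 < Q := hε.trans_le hεQ
  -- Chosen so that a set `I` of `s + 1` indices has weight `ε⁻¹` if `0 ∉ I`, and `Q⁻¹` otherwise.
  set β : ℝ := ε⁻¹ ^ (((s + 1 : ℕ) : ℝ)⁻¹) with hβdef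
  have hβ : 0 < β := by positivity
  have hβpow : β ^ (s + 1) = ε⁻¹ := Real.rpow_inv_natCast_pow (by positivity) (by omega)
  set w : Fin (n + 1) → ℝ := Fin.cons ((Q * β ^ s)⁻¹) fun _ => β
  have hw : ∀ i, 0 < w i := fun i => by
    refine Fin.cases ?_ (fun i => ?_) i
    · simp only [w, Fin.cons_zero]
      positivity
    · simpa only [w, Fin.cons_succ] using hβ
  have hw0 : ∀ I : Set.powersetCard (Fin (n + 1)) (s + 1), 0 ∈ I → weight w I = Q⁻¹ := by
    intro I hI
    rw [weight_of_mem _ _ hI, mul_inv, mul_assoc, inv_mul_cancel₀ (by positivity), mul_one]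
  have hw1 : ∀ I : Set.powersetCard (Fin (n + 1)) (s + 1), 0 ∉ I → weight w I = ε⁻¹ := by
    intro I hI
    rw [weight_of_notMem _ _ hI, hβpow]
  obtain ⟨h1, h2, -, -⟩ := hK X
  obtain ⟨m, hm, hmI⟩ := hC w hw X hX hX0 K (by
    intro I
    by_cases hI : 0 ∈ I
    · rw [hw0 I hI, ← div_eq_mul_inv, div_le_iff₀ hQ]
      exact (h1 I).trans (by gcongr)
    · rw [hw1 I hI, ← div_eq_mul_inv, div_le_iff₀ hε]
      exact (h2 I hI).trans (by gcongr))
  obtain ⟨-, -, h3, h4⟩ := hK (exteriorPower.ιMulti ℝ (s + 1) fun i => intVec (m i))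
  have hbound : ∀ I, 0 ∉ I → |(F.exteriorPower (s + 1)).repr
      (exteriorPower.ιMulti ℝ (s + 1) fun i => intVec (m i)) I| ≤ C * K * ε := by
    intro I hI
    have h := hmI I
    rwa [hw1 I hI, ← div_eq_mul_inv, div_le_iff₀ hε] at h
  refine ⟨m, hm, ?_, ?_⟩
  · rw [mul_assoc]
    refine h3 _ (by positivity) fun I => ?_
    by_cases hI : 0 ∈ I
    · have h := hmI I
      rwa [hw0 I hI, ← div_eq_mul_inv, div_le_iff₀ hQ] at h
    · exact (hbound I hI).trans (by gcongr)
  · rw [mul_assoc]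
    exact h4 _ (by positivity) hbound

/-! ### Comparison of the exponents -/

/-- A point with linearly independent coordinates lies on no proper rational subspace. -/
lemma homog_notMem {n : ℕ} {θ : Fin n → ℝ}
    (hθ : LinearIndependent ℚ (Fin.cons 1 θ : Fin (n + 1) → ℝ)) {L : Submodule ℝ (E n)}
    (hL : IsRational L) (hfin : Module.finrank ℝ L < n + 1) : homog θ ∉ L := by
  intro hy
  have hlt : rationalPoints L < ⊤ := by
    refine lt_top_iff_ne_top.2 fun h => ?_
    have h1 := finrank_rationalPoints hL
    rw [h, finrank_top, Module.finrank_fin_fun] at h1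
    omega
  -- A nonzero rational functional vanishing on the rational points of `L` vanishes on `L`, hence at
  -- `y`: a rational relation between `1, θ_1, …, θ_n`.
  obtain ⟨f, hf0, hf⟩ := Submodule.exists_le_ker_of_lt_top _ hlt
  let g : E n →ₗ[ℝ] ℝ := ∑ i, (f (Pi.single i 1) : ℝ) • (EuclideanSpace.proj i).toLinearMap
  have hg : ∀ x, g x = ∑ i, (f (Pi.single i 1) : ℝ) * x i := fun x => by simp [g]
  have hgq : ∀ q, g (ratVec q) = (f q : ℝ) := by
    intro q
    rw [hg]
    conv_rhs => rw [LinearMap.pi_apply_eq_sum_univ f q]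
    have e : ∀ i : Fin (n + 1), (fun j => if i = j then (1 : ℚ) else 0) = Pi.single i 1 := by
      intro i
      ext j
      simp [Pi.single_apply, eq_comm]
    simp [ratVec, mul_comm, e]
  have hgL : L ≤ LinearMap.ker g := by
    rw [← hL, Submodule.span_le]
    rintro _ ⟨q, hq, rfl⟩
    have : f q = 0 := hf hq
    simp [hgq, this]
  have hgy : g (homog θ) = 0 := hgL hy
  apply hf0
  refine LinearMap.pi_ext' fun i => LinearMap.ext_ring ?_
  have h := Fintype.linearIndependent_iff.1 hθ (fun i => f (Pi.single i 1)) (by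
    rw [hg] at hgy
    simpa [Rat.smul_def, homog] using hgy) i
  simpa using h

/-- The rational subspaces of dimension `d` approximating `θ` with exponent `ω`. -/
def approxSubspaces {n : ℕ} (d : ℕ) (θ : Fin n → ℝ) (ω : ℝ) : Set (Submodule ℝ (E n)) :=
  {L | IsRational L ∧ Module.finrank ℝ L = d + 1 ∧ distTo (point θ) L ≤ height L ^ (-1 - ω)}

/-- The integer multivectors approximating `θ` with exponent `ω`. -/
def approxMultivectors {n : ℕ} (d : ℕ) (θ : Fin n → ℝ) (ω : ℝ) : Set (⋀[ℝ]^(d + 1) (E n)) :=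
  {X | X ∈ integerMultivectors n (d + 1) ∧ ‖wedge (homog θ) X‖ ≤ ‖X‖ ^ (-ω)}

/-- The first bound puts the span of the `m i` in the set; the second makes its distance to `Θ`
smaller than any prescribed positive constant, whereas finitely many subspaces stay at a positive
distance. -/
lemma infinite_approxSubspaces_of_forall {n d : ℕ} (hd : d + 1 ≤ n) {θ : Fin n → ℝ}
    (hθ : LinearIndependent ℚ (Fin.cons 1 θ : Fin (n + 1) → ℝ)) {ω : ℝ} (hω : -1 ≤ ω)
    (h : ∀ δ : ℝ, 0 < δ → ∃ m : Fin (d + 1) → Fin (n + 1) → ℤ,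
      LinearIndependent ℝ (fun i => intVec (m i)) ∧
      ‖wedge (homog θ) (exteriorPower.ιMulti ℝ (d + 1) fun i => intVec (m i))‖ ≤
        ‖homog θ‖ * ‖exteriorPower.ιMulti ℝ (d + 1) fun i => intVec (m i)‖ ^ (-ω) ∧
      ‖wedge (homog θ) (exteriorPower.ιMulti ℝ (d + 1) fun i => intVec (m i))‖ <
        δ * ‖exteriorPower.ιMulti ℝ (d + 1) fun i => intVec (m i)‖) :
    (approxSubspaces d θ ω).Infinite := by
  intro hfin
  have hy : 0 < ‖homog θ‖ := norm_pos_iff.2 (homog_ne_zero θ)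
  obtain ⟨δ, hδ, hδ0⟩ : ∃ δ : ℝ, (∀ L ∈ approxSubspaces d θ ω, δ ≤ distTo (point θ) L) ∧ 0 < δ := by
    have h1 : ∀ᶠ δ in nhdsWithin (0 : ℝ) (Set.Ioi 0),
        ∀ L ∈ approxSubspaces d θ ω, δ ≤ distTo (point θ) L := by
      rw [Filter.eventually_all_finite hfin]
      rintro L ⟨hL, hrk, -⟩
      have hbot : L ≠ ⊥ := by
        rintro rfl
        simp at hrk
      have hpos := distTo_pos (homog θ) (homog_ne_zero θ) hbot (homog_notMem hθ hL (by omega))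
      filter_upwards [Ioo_mem_nhdsGT hpos] with δ hδ using hδ.2.le
    exact (h1.and self_mem_nhdsWithin).exists
  obtain ⟨m, hm, h1, h2⟩ := h (δ * ‖homog θ‖) (by positivity)
  set X := exteriorPower.ιMulti ℝ (d + 1) fun i => intVec (m i)
  have hX : 0 < ‖X‖ := norm_pos_iff.2 (ιMulti_ne_zero hm)
  set L := Submodule.span ℝ (Set.range fun i => intVec (m i))
  have hdist := norm_wedge_eq_distTo (homog θ) (homog_ne_zero θ) hm
  change ‖wedge (homog θ) X‖ = ‖homog θ‖ * ‖X‖ * distTo (point θ) L at hdist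
  obtain ⟨hh0, hh⟩ := height_span_intVec hm
  change height L ≤ ‖X‖ at hh
  have hL : L ∈ approxSubspaces d θ ω := by
    refine ⟨isRational_span_ratVec _, ?_, ?_⟩
    · rw [finrank_span_eq_card hm, Fintype.card_fin]
    -- The `m i` may span a non-primitive lattice, so only `height L ≤ ‖X‖` holds; `-1 ≤ ω` makes
    -- the exponent nonpositive, the favourable direction.
    · refine le_trans ?_ (Real.rpow_le_rpow_of_nonpos hh0 hh (by linarith))
      rw [hdist, mul_assoc] at h1
      have h3 := le_of_mul_le_mul_left h1 hy
      rw [show -1 - ω = -ω - 1 by ring, Real.rpow_sub_one hX.ne', le_div_iff₀ hX, mul_comm]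
      exact h3
  have h3 := hδ L hL
  rw [hdist] at h2
  have : ‖homog θ‖ * ‖X‖ * δ ≤ ‖homog θ‖ * ‖X‖ * distTo (point θ) L := by gcongr
  linarith

/-- Simultaneous approximations `k θ ≈ x` yield subspaces for every negative exponent. -/
lemma infinite_approxSubspaces_of_neg {n d : ℕ} (hd : d + 1 ≤ n) {θ : Fin n → ℝ}
    (hθ : LinearIndependent ℚ (Fin.cons 1 θ : Fin (n + 1) → ℝ)) {ω : ℝ} (hω : -1 ≤ ω)
    (hω0 : ω < 0) : (approxSubspaces d θ ω).Infinite := by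
  apply infinite_approxSubspaces_of_forall hd hθ hω
  intro δ hδ
  set y := homog θ
  have hy : 0 < ‖y‖ := norm_pos_iff.2 (homog_ne_zero θ)
  -- The canonical vectors of indices `1, …, d`, all with zero coordinate of index `0`. With the
  -- rounding `x` of `k • y` they span a subspace at distance `O(1/k)` from `Θ`, while the wedge has
  -- norm of order `k`.
  let e : Fin d → Fin (n + 1) → ℤ := fun i => Pi.single (Fin.castLE hd i.castSucc).succ 1
  set Z := exteriorPower.ιMulti ℝ d fun i => intVec (e i)
  have he : LinearIndependent ℝ fun i => intVec (e i) := by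
    have h := (EuclideanSpace.basisFun (Fin (n + 1)) ℝ).toBasis.linearIndependent.comp
      (fun i : Fin d => (Fin.castLE hd i.castSucc).succ) (fun i j hij => by
        simpa [Fin.ext_iff] using hij)
    convert! h using 1
    funext i
    simp only [e, intVec_single, Function.comp_apply, OrthonormalBasis.coe_toBasis]
  have hZ : 1 ≤ ‖Z‖ := one_le_norm_of_mem_integerMultivectors (ιMulti_intVec_mem e)
    (ιMulti_ne_zero he)
  set c := √((n : ℝ) + 1)
  obtain ⟨k, hk1, hk2, hk3⟩ : ∃ k : ℕ, 1 ≤ k ∧ c < δ * k ∧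
      c * (‖y‖ + c) * ‖Z‖ ≤ ‖y‖ * (k : ℝ) ^ (-ω) := by
    have h1 : Filter.Tendsto (fun k : ℕ => δ * (k : ℝ)) Filter.atTop Filter.atTop :=
      tendsto_natCast_atTop_atTop.const_mul_atTop hδ
    have h2 : Filter.Tendsto (fun k : ℕ => ‖y‖ * (k : ℝ) ^ (-ω)) Filter.atTop Filter.atTop :=
      ((tendsto_rpow_atTop (by linarith)).comp tendsto_natCast_atTop_atTop).const_mul_atTop hy
    exact ((Filter.eventually_ge_atTop 1).and ((h1.eventually_gt_atTop _).and
      (h2.eventually_ge_atTop _))).exists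
  have hk : (1 : ℝ) ≤ k := by exact_mod_cast hk1
  let x : Fin (n + 1) → ℤ := fun i => round ((k : ℝ) * y i)
  have hx0 : x 0 = k := by
    simp [x, y, homog]
  have hxy : ‖(k : ℝ) • y - intVec x‖ ≤ c := by
    rw [EuclideanSpace.norm_eq]
    apply Real.sqrt_le_sqrt
    have : ∀ i, ‖((k : ℝ) • y - intVec x) i‖ ^ 2 ≤ 1 := by
      intro i
      have h : ((k : ℝ) • y - intVec x) i = k * y i - round (k * y i) := by
        simp [intVec, ratVec, x]
      rw [h, Real.norm_eq_abs, sq_le_one_iff_abs_le_one, abs_abs]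
      exact (abs_sub_round _).trans (by norm_num)
    refine (Finset.sum_le_card_nsmul _ _ 1 fun i _ => this i).trans ?_
    simp
  let m : Fin (d + 1) → Fin (n + 1) → ℤ := Fin.cons x e
  have hmcons : (fun i => intVec (m i)) = (Fin.cons (intVec x) fun i => intVec (e i) :
      Fin (d + 1) → E n) := by
    funext i
    refine Fin.cases ?_ (fun i => ?_) i <;> simp [m]
  set X := exteriorPower.ιMulti ℝ (d + 1) fun i => intVec (m i)
  have hXZ : X = wedge (intVec x) Z := by
    rw [wedge_ιMulti, ← hmcons]
  have hXnorm := norm_wedge_ιMulti (intVec x) fun i => intVec (e i)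
  rw [← hXZ] at hXnorm
  set W := Submodule.span ℝ (Set.range fun i => intVec (e i))
  have hW : ∀ z ∈ W, z 0 = 0 := by
    intro z hz
    induction hz using Submodule.span_induction with
    | mem z hz =>
      obtain ⟨i, rfl⟩ := hz
      simp [e, intVec, ratVec]
    | zero => simp
    | add a b _ _ ha hb => simp [ha, hb]
    | smul a b _ hb => simp [hb]
  -- The coordinate of index `0` of `x` is exactly `k`, and projecting onto `W` does not affect it.
  have hlow : (k : ℝ) ≤ ‖X‖ := by
    rw [hXnorm]
    have h1 : (k : ℝ) ≤ ‖intVec x - W.starProjection (intVec x)‖ := by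
      have h := PiLp.norm_apply_le (intVec x - W.starProjection (intVec x)) 0
      have h0 : (intVec x - W.starProjection (intVec x)) 0 = (k : ℝ) := by
        rw [PiLp.sub_apply, hW _ (Submodule.starProjection_apply_mem _ _)]
        simp [intVec, ratVec, hx0]
      rwa [h0, Real.norm_of_nonneg (by positivity)] at h
    calc (k : ℝ) = k * 1 := (mul_one _).symm
      _ ≤ _ := by gcongr
  have hup : ‖X‖ ≤ k * (‖y‖ + c) * ‖Z‖ := by
    rw [hXnorm]
    gcongr
    have h1 := norm_sub_starProjection_le W (intVec x) (zero_mem W)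
    rw [sub_zero] at h1
    have h2 := norm_sub_norm_le (intVec x) ((k : ℝ) • y)
    rw [norm_sub_rev, norm_smul, Real.norm_of_nonneg (by positivity)] at h2
    have : c ≤ k * c := le_mul_of_one_le_left (Real.sqrt_nonneg _) hk
    linarith
  have hX : 0 < ‖X‖ := lt_of_lt_of_le (by positivity) hlow
  have hwedge : k * ‖wedge y X‖ ≤ c * ‖X‖ := by
    rw [norm_wedge_ιMulti, ← mul_assoc]
    gcongr
    set L := Submodule.span ℝ (Set.range fun i => intVec (m i))
    have hxL : (k : ℝ)⁻¹ • intVec x ∈ L := Submodule.smul_mem _ _ (Submodule.subset_span ⟨0, rfl⟩)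
    calc (k : ℝ) * ‖y - L.starProjection y‖ ≤ k * ‖y - (k : ℝ)⁻¹ • intVec x‖ := by
          gcongr
          exact norm_sub_starProjection_le L y hxL
      _ = ‖(k : ℝ) • (y - (k : ℝ)⁻¹ • intVec x)‖ := by
          rw [norm_smul, Real.norm_of_nonneg (by positivity)]
      _ = ‖(k : ℝ) • y - intVec x‖ := by
          rw [smul_sub, smul_smul, mul_inv_cancel₀ (by positivity), one_smul]
      _ ≤ c := hxy
  have hkpos : (0 : ℝ) < k := by linarith
  refine ⟨m, (linearIndependent_iff_ιMulti_ne_zero _).2 (norm_pos_iff.1 hX), ?_, ?_⟩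
  · have h1 : ‖wedge y X‖ ≤ c * (‖y‖ + c) * ‖Z‖ := by
      refine le_of_mul_le_mul_left (hwedge.trans ?_) hkpos
      calc c * ‖X‖ ≤ c * (k * (‖y‖ + c) * ‖Z‖) := by gcongr
        _ = _ := by ring
    refine h1.trans (hk3.trans ?_)
    gcongr
    linarith
  · refine lt_of_mul_lt_mul_left (hwedge.trans_lt ?_) hkpos.le
    calc c * ‖X‖ < δ * k * ‖X‖ := by gcongr
      _ = _ := by ring

lemma infinite_approxMultivectors {n d : ℕ} {θ : Fin n → ℝ} {ω ω' : ℝ} (hω : ω' < ω)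
    (h : (approxSubspaces d θ ω).Infinite) : (approxMultivectors d θ ω').Infinite := by
  set y := homog θ
  have hy : 0 < ‖y‖ := norm_pos_iff.2 (homog_ne_zero θ)
  have hex : ∀ L : approxSubspaces d θ ω, ∃ X : ⋀[ℝ]^(d + 1) (E n),
      X ∈ integerMultivectors n (d + 1) ∧ ‖wedge y X‖ ≤ ‖y‖ * ‖X‖ ^ (-ω) ∧
        ∀ z, z ∈ (L : Submodule ℝ (E n)) ↔ wedge z X = 0 := by
    rintro ⟨L, hL, hrk, hdist⟩
    let b : Module.Basis (Fin (d + 1)) ℚ (rationalPoints L) :=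
      Module.finBasisOfFinrankEq ℚ _ ((finrank_rationalPoints hL).trans hrk)
    obtain ⟨c, X, hc, hX, hXh, hXc, -⟩ := exists_integerMultivector b
    have hli := linearIndependent_ratVec_basis L b
    have hspan := span_ratVec_basis hL b
    have hX0 : 0 < ‖X‖ := by
      rw [hXc]
      exact norm_pos_iff.2 (smul_ne_zero hc (ιMulti_ne_zero hli))
    refine ⟨X, hX, ?_, fun z => ?_⟩
    · have h1 := norm_wedge_eq_distTo y (homog_ne_zero θ) hli
      rw [hspan] at h1
      have h2 : ‖wedge y X‖ = ‖y‖ * (‖X‖ * distTo (point θ) L) := by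
        rw [hXc, wedge_smul, norm_smul, h1, norm_smul, point]
        ring
      rw [h2]
      gcongr
      rw [← hXh, show -1 - ω = -ω - 1 by ring, Real.rpow_sub_one hX0.ne', le_div_iff₀ hX0] at hdist
      linarith
    · rw [hXc, wedge_smul, smul_eq_zero, or_iff_right hc, wedge_ιMulti_eq_zero_iff hli, hspan]
  choose X hX hXy hXL using hex
  have hinj : Function.Injective X := by
    intro L L' hLL
    apply Subtype.ext
    ext z
    rw [hXL, hXL, hLL]
  have : Infinite (approxSubspaces d θ ω) := h.to_subtype
  have hinf := Set.infinite_range_of_injective hinj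
  -- Beyond norm `R` the gap `ω - ω'` absorbs `‖y‖`; only finitely many integer multivectors are
  -- lost.
  obtain ⟨R, hR⟩ : ∃ R : ℝ, ∀ t, R ≤ t → ‖y‖ ≤ t ^ (ω - ω') :=
    Filter.eventually_atTop.1 ((tendsto_rpow_atTop (sub_pos.2 hω)).eventually_ge_atTop ‖y‖)
  refine (hinf.sdiff (finite_integerMultivectors_le n (d + 1) (max R 0))).mono ?_
  rintro _ ⟨⟨L, rfl⟩, hL⟩
  refine ⟨hX L, ?_⟩
  have hlt : max R 0 < ‖X L‖ := by
    by_contra! hcon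
    exact hL ⟨hX L, hcon⟩
  have hpos : 0 < ‖X L‖ := (le_max_right _ _).trans_lt hlt
  calc ‖wedge y (X L)‖ ≤ ‖y‖ * ‖X L‖ ^ (-ω) := hXy L
    _ ≤ ‖X L‖ ^ (ω - ω') * ‖X L‖ ^ (-ω) := by
      gcongr
      exact hR _ ((le_max_left _ _).trans hlt.le)
    _ = ‖X L‖ ^ (-ω') := by
      rw [← Real.rpow_add hpos]
      congr 1
      ring

lemma infinite_approxSubspaces_of_approxMultivectors {n d : ℕ} (hd : d + 1 ≤ n) {θ : Fin n → ℝ}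
    (hθ : LinearIndependent ℚ (Fin.cons 1 θ : Fin (n + 1) → ℝ)) {ω ω' : ℝ} (hω' : 0 ≤ ω')
    (hω : ω' < ω) (h : (approxMultivectors d θ ω).Infinite) :
    (approxSubspaces d θ ω').Infinite := by
  apply infinite_approxSubspaces_of_forall hd hθ (by linarith)
  intro δ hδ
  set y := homog θ
  have hy : 0 < ‖y‖ := norm_pos_iff.2 (homog_ne_zero θ)
  obtain ⟨C, hC0, hC⟩ := exists_decomposable_le (s := d) (by omega) (homog_ne_zero θ)
  -- The first condition absorbs the constants of `exists_decomposable_le`; the second, which needs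
  -- `ω > 0`, makes `‖y ∧ X'‖` smaller than `δ`.
  obtain ⟨R, hR⟩ : ∃ R : ℝ, ∀ t, R ≤ t → C * C ^ ω' ≤ ‖y‖ * t ^ (ω - ω') ∧ C < δ * t ^ ω :=
    Filter.eventually_atTop.1
      ((((tendsto_rpow_atTop (sub_pos.2 hω)).const_mul_atTop hy).eventually_ge_atTop _).and
        (((tendsto_rpow_atTop (by linarith)).const_mul_atTop hδ).eventually_gt_atTop _))
  obtain ⟨X, ⟨hX, hXy⟩, hXR⟩ :=
    (h.sdiff (finite_integerMultivectors_le n (d + 1) (max R 1))).nonempty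
  set Q := ‖X‖
  have hlt : max R 1 < Q := by
    by_contra! hcon
    exact hXR ⟨hX, hcon⟩
  have hQ1 : 1 < Q := (le_max_right _ _).trans_lt hlt
  have hQ : 0 < Q := by linarith
  obtain ⟨hR1, hR2⟩ := hR Q ((le_max_left _ _).trans hlt.le)
  have hε : Q ^ (-ω) ≤ Q :=
    (Real.rpow_le_one_of_one_le_of_nonpos hQ1.le (by linarith)).trans hQ1.le
  obtain ⟨m, hm, hm1, hm2⟩ := hC X hX (norm_pos_iff.1 hQ) Q (Q ^ (-ω)) (by positivity) hε le_rfl hXy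
  set X' := exteriorPower.ιMulti ℝ (d + 1) fun i => intVec (m i)
  have hX' : 1 ≤ ‖X'‖ := one_le_norm_of_mem_integerMultivectors (ιMulti_intVec_mem m)
    (ιMulti_ne_zero hm)
  refine ⟨m, hm, hm2.trans ?_, hm2.trans_lt ?_⟩
  · have h1 : (C * Q) ^ (-ω') ≤ ‖X'‖ ^ (-ω') :=
      Real.rpow_le_rpow_of_nonpos (by linarith) hm1 (by linarith)
    refine le_trans ?_ (mul_le_mul_of_nonneg_left h1 hy.le)
    rw [Real.mul_rpow hC0.le hQ.le]
    calc C * Q ^ (-ω) = C * C ^ ω' * (C ^ (-ω') * Q ^ (-ω)) := by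
          rw [Real.rpow_neg hC0.le]
          field_simp
      _ ≤ ‖y‖ * Q ^ (ω - ω') * (C ^ (-ω') * Q ^ (-ω)) := by gcongr
      _ = ‖y‖ * (C ^ (-ω') * (Q ^ (ω - ω') * Q ^ (-ω))) := by ring
      _ = _ := by
          rw [← Real.rpow_add hQ]
          congr 4
          ring
  · rw [Real.rpow_neg hQ.le]
    calc C * (Q ^ ω)⁻¹ < δ * Q ^ ω * (Q ^ ω)⁻¹ := by gcongr
      _ = δ * 1 := by
          have : Q ^ ω ≠ 0 := by positivity
          field_simp
      _ ≤ δ * ‖X'‖ := by gcongr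

/-- Allows an arbitrarily small loss in the exponent. -/
lemma coe_le_sSup_of_forall_lt {A : Set ℝ} {ω : ℝ} (h : ∀ ω' < ω, ∃ t ∈ A, ω' ≤ t) :
    (ω : EReal) ≤ sSup (Real.toEReal '' A) := by
  refine le_of_forall_lt fun c hc => ?_
  obtain ⟨x, hx1, hx2⟩ := EReal.lt_iff_exists_real_btwn.1 hc
  obtain ⟨t, htA, ht⟩ := h x (by exact_mod_cast hx2)
  exact hx1.trans_le ((EReal.coe_le_coe_iff.2 ht).trans (le_sSup ⟨t, htA, rfl⟩))

end SubspaceApprox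

theorem mainTheorem5 (n d : ℕ) (hn : 1 ≤ n) (hd : d ≤ n - 1) (θ : Fin n → ℝ)
    (hθ : LinearIndependent ℚ (Fin.cons 1 θ : Fin (n + 1) → ℝ)) :
    SubspaceApprox.omega d θ =
      sSup (Real.toEReal '' {ω : ℝ | {X : ⋀[ℝ]^(d + 1) (SubspaceApprox.E n) |
        X ∈ SubspaceApprox.integerMultivectors n (d + 1) ∧
          ‖SubspaceApprox.wedge (SubspaceApprox.homog θ) X‖ ≤ ‖X‖ ^ (-ω)}.Infinite}) := by
  have hd' : d + 1 ≤ n := by omega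
  apply le_antisymm
  · refine sSup_le ?_
    rintro _ ⟨ω, hω, rfl⟩
    exact SubspaceApprox.coe_le_sSup_of_forall_lt fun ω' hω' =>
      ⟨ω', SubspaceApprox.infinite_approxMultivectors hω' hω, le_rfl⟩
  · refine sSup_le ?_
    rintro _ ⟨ω, hω, rfl⟩
    refine SubspaceApprox.coe_le_sSup_of_forall_lt fun ω' hω' => ?_
    -- Below `0` nothing is needed from the multivectors; `max ω' (-1)` keeps the exponent in the
    -- range where the height comparison works.
    rcases lt_or_ge ω' 0 with h0 | h0
    · exact ⟨max ω' (-1), SubspaceApprox.infinite_approxSubspaces_of_neg hd' hθ (le_max_right _ _)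
        (max_lt h0 (by norm_num)), le_max_left _ _⟩
    · exact ⟨ω', SubspaceApprox.infinite_approxSubspaces_of_approxMultivectors hd' hθ h0 hω' hω,
        le_rfl⟩
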